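/- Assume the generalized Riemann hypothesis for Dirichlet $L$-functions: for every Dirichlet character $\chi$ of every modulus, each zero of $L(s,\chi)$ with $0<\operatorname{Re} s<1$ has $\operatorname{Re} s=\tfrac12$. For a prime $m$ let $X_m$ be the set of non-principal Dirichlet characters modulo $m$. Put $\mathcal L(s,\chi)=L'(s,\chi)/L(s,\chi)$, write $\mathcal L^{(r)}(s,\chi)$ for its $r$-th derivative in $s$, and for integers $a,b\ge 0$ put $P^{(a,b)}(z)=z^a\,\overline z^{\,b}$ (with $z^0=1$ for all $z$). For integers $r\ge 0$ and $n\ge 1$ define $$\Lambda_{r,k}(n)=\sum_{n=n_1\cdots n_k}\Lambda(n_1)\cdots\Lambda(n_k)\,(\log n_1)^r\cdots(\log n_k)^r\quad(k\ge 1),$$ where $\Lambda$ is the von Mangoldt function and the sum runs over ordered $k$-tuples of positive integers with product $n$, and let $\Lambda_{r,0}(n)=1$ if $n=1$ and $0$ otherwise. Then, for all integers $a,b\ge 0$: (i) for every $r\ge 0$ the series $$\mu^{(a,b)}(r)=\sum_{j=1}^{\infty}\frac{\Lambda_{r,a}(j)\,\Lambda_{r,b}(j)}{j^2}$$ converges;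 (ii) there is a constant $C=C(a,b)$ such that for every $r\ge 0$ there is $m_0=m_0(r,a,b)$ such that for all primes $m\ge m_0$ $$\left|\frac1{|X_m|}\sum_{\chi\in X_m}P^{(a,b)}\bigl(\mathcal L^{(r)}(1,\chi)\bigr)-(-1)^{(r+1)(a+b)}\mu^{(a,b)}(r)\right|\le C\,\frac{(\log m)^{(r+1)(a+b)+2}}{m};$$ (iii) in particular, for every $r\ge 0$, as $m\to\infty$ through primes, $$\lim_{m\to\infty}\frac1{|X_m|}\sum_{\chi\in X_m}P^{(a,b)}\bigl(\mathcal L^{(r)}(1,\chi)\bigr)=(-1)^{(r+1)(a+b)}\mu^{(a,b)}(r).$$ -/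

import Mathlib

open Filter Topology

/-- The generalized Riemann hypothesis for Dirichlet `L`-functions: every zero of `L(s, χ)` in the
open critical strip `0 < Re s < 1` lies on the line `Re s = 1/2`, for every Dirichlet character `χ`
of every modulus. (The trivial character modulo `1` gives the Riemann zeta function.) -/
def GeneralizedRiemannHypothesis : Prop :=
  ∀ (N : ℕ) [NeZero N] (χ : DirichletCharacter ℂ N) (s : ℂ),
    0 < s.re → s.re < 1 → DirichletCharacter.LFunction χ s = 0 → s.re = 1 / 2

instance neZeroPrimes (p : Nat.Primes) : NeZero (p : ℕ) := ⟨p.2.ne_zero⟩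

/-- `P^{(a,b)}(z) = z ^ a * conj z ^ b`. -/
noncomputable def momentPoly (a b : ℕ) (z : ℂ) : ℂ :=
  z ^ a * (starRingEnd ℂ z) ^ b

/-- `𝓛^{(r)}(1, χ)`: the `r`-th derivative at `s = 1` of `𝓛(s, χ) = L'(s, χ) / L(s, χ)`. -/
noncomputable def logDerivLAtOne {m : ℕ} [NeZero m] (r : ℕ) (χ : DirichletCharacter ℂ m) : ℂ :=
  iteratedDeriv r
    (fun s : ℂ => deriv (DirichletCharacter.LFunction χ) s / DirichletCharacter.LFunction χ s) 1

open scoped Classical in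
/-- `X_m`: the non-principal Dirichlet characters modulo `m`. (For `m` prime they are all
primitive.) -/
noncomputable def nonprincipalChars (m : ℕ) [NeZero m] : Finset (DirichletCharacter ℂ m) :=
  Finset.univ.filter (fun χ => χ ≠ 1)

/-- The average of `P^{(a,b)}(𝓛^{(r)}(1, χ))` over `χ ∈ X_m`. -/
noncomputable def moment (m : ℕ) [NeZero m] (r a b : ℕ) : ℂ :=
  (1 / ((nonprincipalChars m).card : ℂ)) *
    ∑ χ ∈ nonprincipalChars m, momentPoly a b (logDerivLAtOne r χ)

/-- `Λ_{r,k}(n) = ∑_{n = n₁ ⋯ n_k} Λ(n₁) ⋯ Λ(n_k) (log n₁)^r ⋯ (log n_k)^r`, the sum being over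
ordered `k`-tuples of positive integers with product `n`. For `k = 0` only the empty product
occurs, see `vonMangoldtConv_zero`. -/
noncomputable def vonMangoldtConv (r k n : ℕ) : ℝ :=
  ∑ d ∈ Nat.finMulAntidiag k n,
    ∏ i : Fin k, (ArithmeticFunction.vonMangoldt (d i) * Real.log (d i : ℝ) ^ r)

theorem vonMangoldtConv_zero (r n : ℕ) : vonMangoldtConv r 0 n = if n = 1 then 1 else 0 := by
  unfold vonMangoldtConv
  split_ifs with h
  · subst h
    simp [Nat.finMulAntidiag_one]
  · simp [Nat.finMulAntidiag_zero_left h]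

/-- The `j`-th term `Λ_{r,a}(j) Λ_{r,b}(j) / j²` of `μ^{(a,b)}(r)`. -/
noncomputable def muTerm (a b r j : ℕ) : ℝ :=
  vonMangoldtConv r a j * vonMangoldtConv r b j / (j : ℝ) ^ 2

/-- `μ^{(a,b)}(r) = ∑_{j ≥ 1} Λ_{r,a}(j) Λ_{r,b}(j) / j²`. -/
noncomputable def mu (a b r : ℕ) : ℝ :=
  ∑' j : ℕ+, muTerm a b r j

/-! Under GRH the function `G(s) = 𝓛^{(r)}(s, χ)^a` is holomorphic for `Re s > 1/2`, hence on a
neighbourhood of the disc `|s - 2| ≤ 9/8`, which has 1 in its interior; Borel–Carathéodory bounds it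
there by a constant times `m^a` (`norm_iteratedDeriv_logDeriv_le`). The first `K` Taylor terms at 2
therefore give `G(1)` with error `O(m^a (8/9)^K)`. The derivatives at 2 are absolutely convergent
Dirichlet series, and together these terms form, up to sign, the sum of `χ(n) Λ_{r,a}(n) w(n) / n`
with `w(n) = e^{-log n} ∑_{k<K} (log n)^k / k!`. This `poissonWeight` is a smooth cutoff near `n =
e^K` (`norm_logDerivLAtOne_pow_sub_le`).

Averaging the product of two such sums over all characters leaves the pairs `i ≡ j` mod `m` prime to
`m`. The diagonal gives `μ` up to `O((4/5)^K + 1/m)`. Off the diagonal the larger entry is at least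
a positive multiple of `m`, which saves a factor `m`; the remaining sums cost only powers of `K`, in
total `K^{(r+1)(a+b)+1} / m` (`abs_tsum_congruent_sub_diag_le`, `truncated_mean`). Removing the
principal character costs no more.

With `K` a large multiple of `log m` the Taylor error is negligible (`moment_sub_le`). The result
has one logarithm fewer than claimed; for large `m` the spare one absorbs every constant depending
on `r`. -/

/-! ### Tail bounds for the Poisson cutoff. -/

/-- The probability that a Poisson variable of mean `y` is less than `K`. -/
noncomputable def poissonWeight (K : ℕ) (y : ℝ) : ℝ :=
  Real.exp (-y) * ∑ k ∈ Finset.range K, y ^ k / (k.factorial : ℝ)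

theorem poissonWeight_nonneg (K : ℕ) {y : ℝ} (hy : 0 ≤ y) : 0 ≤ poissonWeight K y := by
  unfold poissonWeight; positivity

theorem poissonWeight_le_one (K : ℕ) {y : ℝ} (hy : 0 ≤ y) : poissonWeight K y ≤ 1 := by
  unfold poissonWeight
  calc _ ≤ Real.exp (-y) * Real.exp y := by gcongr; exact Real.sum_le_exp_of_nonneg hy K
    _ = 1 := by rw [← Real.exp_add]; simp

/-- Chernoff's argument: `t ^ K ≤ t ^ k` for `k < K` and `t ≤ 1`, so `t ^ K` times the truncated sum
is at most the full series at `t * y`. -/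
theorem poissonWeight_le (K : ℕ) {y t : ℝ} (hy : 0 ≤ y) (ht : 0 < t) (ht1 : t ≤ 1) :
    poissonWeight K y ≤ (t ^ K)⁻¹ * Real.exp ((t - 1) * y) := by
  have key : t ^ K * ∑ k ∈ Finset.range K, y ^ k / (k.factorial : ℝ) ≤ Real.exp (t * y) := by
    refine le_trans ?_ (Real.sum_le_exp_of_nonneg (by positivity) K)
    rw [Finset.mul_sum]
    refine Finset.sum_le_sum fun k hk => ?_
    rw [mul_pow, mul_div_assoc]
    have : t ^ K ≤ t ^ k := pow_le_pow_of_le_one ht.le ht1 (Finset.mem_range.1 hk).le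
    gcongr
  unfold poissonWeight
  rw [inv_mul_eq_div, le_div_iff₀ (by positivity)]
  calc _ = Real.exp (-y) * (t ^ K * ∑ k ∈ Finset.range K, y ^ k / (k.factorial : ℝ)) := by ring
    _ ≤ Real.exp (-y) * Real.exp (t * y) := by gcongr
    _ = _ := by rw [← Real.exp_add]; ring_nf

theorem one_sub_poissonWeight_le (K : ℕ) {y t : ℝ} (hy : 0 ≤ y) (ht1 : 1 ≤ t) :
    1 - poissonWeight K y ≤ (t ^ K)⁻¹ * Real.exp ((t - 1) * y) := by
  have h1 (x : ℝ) : HasSum (fun k : ℕ => x ^ k / (k.factorial : ℝ)) (Real.exp x) := by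
    rw [Real.exp_eq_exp_ℝ]; exact NormedSpace.expSeries_div_hasSum_exp x
  have hsub (x : ℝ) := (hasSum_nat_add_iff' K).2 (h1 x)
  have key : t ^ K * (Real.exp y - ∑ k ∈ Finset.range K, y ^ k / (k.factorial : ℝ)) ≤
      Real.exp (t * y) := by
    refine le_trans (hasSum_le (fun k => ?_) ((hsub y).mul_left (t ^ K)) (hsub (t * y)))
      (sub_le_self _ (Finset.sum_nonneg fun k _ => by positivity))
    rw [mul_pow, mul_div_assoc]
    have : t ^ K ≤ t ^ (k + K) := pow_le_pow_right₀ ht1 (by omega)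
    gcongr
  have hpos : 0 < t := by linarith
  unfold poissonWeight
  rw [inv_mul_eq_div, le_div_iff₀ (by positivity)]
  have he : Real.exp (-y) * Real.exp y = 1 := by rw [← Real.exp_add]; simp
  calc _ = Real.exp (-y) *
        (t ^ K * (Real.exp y - ∑ k ∈ Finset.range K, y ^ k / (k.factorial : ℝ))) := by
        linear_combination (-t ^ K) * he
    _ ≤ Real.exp (-y) * Real.exp (t * y) := by gcongr
    _ = _ := by rw [← Real.exp_add]; ring_nf

/-- Taking `t = 1 - 1/K` keeps `t ^ (-K)` at most 4. The gain `n ^ (-1/K)` is what makes the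
truncated series at `s = 1` converge. -/
theorem poissonWeight_log_le {K : ℕ} (hK : 2 ≤ K) {n : ℕ} (hn : n ≠ 0) :
    poissonWeight K (Real.log n) ≤ 4 * (n : ℝ) ^ (-(1 / (K : ℝ))) := by
  have hK' : (2 : ℝ) ≤ K := by exact_mod_cast hK
  have hn' : (0 : ℝ) < n := by positivity
  have hinv : 1 / (K : ℝ) ≤ 1 / 2 := one_div_le_one_div_of_le (by norm_num) hK'
  refine (poissonWeight_le K (t := 1 - 1 / K) (Real.log_natCast_nonneg n) (by linarith)
    (by linarith [show 0 ≤ 1 / (K : ℝ) by positivity])).trans ?_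
  have h4 : (1 / 4 : ℝ) ≤ (1 - 1 / K) ^ K := by
    have hq : (0 : ℝ) < 1 - 1 / K := by linarith
    have hb : (1 : ℝ) / 4 ≤ (1 - 1 / K) ^ K := by
      -- Concavity of `log` between `1` and `1/2`, with weights `1 - 2/K` and `2/K`.
      have hlog : -(2 / (K : ℝ)) * Real.log 2 ≤ Real.log (1 - 1 / K) := by
        have hconv := strictConcaveOn_log_Ioi.concaveOn.2
        have hc := @hconv 1 (by simp) (1 / 2) (by simp) (1 - 2 / K) (2 / K)
          (by rw [sub_nonneg, div_le_one (by linarith)]; exact hK') (by positivity) (by ring)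
        simp only [smul_eq_mul, Real.log_one, mul_zero, zero_add, one_div, Real.log_inv] at hc
        have e : (1 - 2 / (K : ℝ)) * 1 + 2 / K * 2⁻¹ = 1 - 1 / K := by ring
        rw [e] at hc
        linarith
      rw [← Real.log_le_log_iff (by norm_num) (by positivity), Real.log_pow]
      have e4 : Real.log (1 / 4) = -2 * Real.log 2 := by
        rw [show (1 / 4 : ℝ) = (2 ^ 2)⁻¹ by norm_num, Real.log_inv, Real.log_pow]; push_cast; ring
      rw [e4]
      calc _ = K * (-(2 / (K : ℝ)) * Real.log 2) := by field_simp
        _ ≤ _ := by gcongr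
    exact hb
  have hpow : Real.exp ((1 - 1 / (K : ℝ) - 1) * Real.log n) = (n : ℝ) ^ (-(1 / (K : ℝ))) := by
    rw [Real.rpow_def_of_pos hn']; ring_nf
  rw [hpow]
  gcongr
  rw [inv_le_comm₀ (by linarith) (by norm_num)]
  linarith

/-- The upper tail with `t = 5/4`: exponentially small in `K` at the cost of `n ^ (1/4)`, which the
factor `1/n²` in `muTerm` can afford. -/
theorem one_sub_poissonWeight_log_le (K : ℕ) {n : ℕ} (hn : n ≠ 0) :
    1 - poissonWeight K (Real.log n) ≤ (4 / 5 : ℝ) ^ K * (n : ℝ) ^ (1 / 4 : ℝ) := by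
  have hn' : (0 : ℝ) < n := by positivity
  refine (one_sub_poissonWeight_le K (t := 5 / 4) (Real.log_natCast_nonneg n)
    (by norm_num)).trans (le_of_eq ?_)
  rw [Real.rpow_def_of_pos hn', ← inv_pow]
  norm_num
  ring_nf

/-! ### The coefficients `Λ_{r,k}` and their twisted Dirichlet series. -/

theorem vonMangoldtConv_nonneg (r k n : ℕ) : 0 ≤ vonMangoldtConv r k n :=
  Finset.sum_nonneg fun _ _ => Finset.prod_nonneg fun _ _ =>
    mul_nonneg ArithmeticFunction.vonMangoldt_nonneg (pow_nonneg (Real.log_natCast_nonneg _) _)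

@[simp] theorem vonMangoldtConv_apply_zero (r k : ℕ) : vonMangoldtConv r k 0 = 0 := by
  simp [vonMangoldtConv]

theorem vonMangoldtConv_succ (r k n : ℕ) :
    vonMangoldtConv r (k + 1) n = ∑ p ∈ n.divisorsAntidiagonal,
      (ArithmeticFunction.vonMangoldt p.1 * Real.log p.1 ^ r) * vonMangoldtConv r k p.2 := by
  simp only [vonMangoldtConv, Finset.mul_sum]
  rw [Finset.sum_sigma']
  refine Finset.sum_bij' (fun d _ => ⟨(d 0, ∏ i, Fin.tail d i), Fin.tail d⟩)
    (fun x _ => Fin.cons x.1.1 x.2) ?_ ?_ ?_ ?_ ?_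
  · intro d hd
    rw [Nat.mem_finMulAntidiag, Fin.prod_univ_succ] at hd
    obtain ⟨h, h0⟩ := hd
    simp only [Finset.mem_sigma, Nat.mem_divisorsAntidiagonal, Nat.mem_finMulAntidiag]
    refine ⟨⟨h, h0⟩, trivial, fun h' => h0 (by rw [← h]; exact mul_eq_zero_of_right _ h')⟩
  · rintro ⟨⟨p, q⟩, d⟩ hx
    simp only [Finset.mem_sigma, Nat.mem_divisorsAntidiagonal, Nat.mem_finMulAntidiag] at hx
    rw [Nat.mem_finMulAntidiag, Fin.prod_univ_succ]
    simp [hx.2.1, hx.1.1, hx.1.2]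
  · intro d _
    simp
  · rintro ⟨⟨p, q⟩, d⟩ hx
    simp only [Finset.mem_sigma, Nat.mem_divisorsAntidiagonal, Nat.mem_finMulAntidiag] at hx
    simp [hx.2.1]
  · intro d _
    rw [Fin.prod_univ_succ]
    rfl

/-- Each further factor contributes `∑_{d ∣ n} Λ(d) = log n` together with at most `(log n)^r`. -/
theorem vonMangoldtConv_le (r k n : ℕ) : vonMangoldtConv r k n ≤ Real.log n ^ ((r + 1) * k) := by
  induction k generalizing n with
  | zero => rw [vonMangoldtConv_zero]; split_ifs <;> simp
  | succ k ih =>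
    rw [vonMangoldtConv_succ]
    have hl := Real.log_natCast_nonneg n
    calc _ ≤ ∑ p ∈ n.divisorsAntidiagonal, ArithmeticFunction.vonMangoldt p.1 *
            (Real.log n ^ r * Real.log n ^ ((r + 1) * k)) := by
          refine Finset.sum_le_sum fun p hp => ?_
          obtain ⟨hpn, hn0⟩ := Nat.mem_divisorsAntidiagonal.1 hp
          have h1 : p.1 ≠ 0 := fun h => hn0 (by rw [← hpn, h, zero_mul])
          have h2 : p.2 ≠ 0 := fun h => hn0 (by rw [← hpn, h, mul_zero])
          have hle1 : Real.log p.1 ≤ Real.log n := Real.log_le_log (by positivity)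
            (by exact_mod_cast Nat.le_of_dvd (Nat.pos_of_ne_zero hn0) ⟨_, hpn.symm⟩)
          have hdvd : p.2 ∣ n := ⟨p.1, by rw [← hpn, mul_comm]⟩
          have hle2 : Real.log p.2 ≤ Real.log n := Real.log_le_log (by positivity)
            (by exact_mod_cast Nat.le_of_dvd (Nat.pos_of_ne_zero hn0) hdvd)
          have := ArithmeticFunction.vonMangoldt_nonneg (n := p.1)
          have := Real.log_natCast_nonneg p.1
          have := Real.log_natCast_nonneg p.2
          have := vonMangoldtConv_nonneg r k p.2
          rw [mul_assoc]
          gcongr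
          exact (ih _).trans (by gcongr)
      _ = Real.log n ^ ((r + 1) * (k + 1)) := by
          rw [← Finset.sum_mul, Nat.sum_divisorsAntidiagonal (fun i _ => ArithmeticFunction.vonMangoldt i),
            ArithmeticFunction.vonMangoldt_sum]
          ring

/-- A power of `log n` is absorbed by any positive power of `n`. -/
theorem log_pow_le_mul_rpow (p : ℕ) {c : ℝ} (hc : 0 < c) {n : ℕ} (hn : n ≠ 0) :
    Real.log n ^ p ≤ p.factorial * c ^ p * (n : ℝ) ^ (1 / c) := by
  have h := Real.pow_div_factorial_le_exp (Real.log n / c)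
    (div_nonneg (Real.log_natCast_nonneg n) hc.le) p
  rw [div_le_iff₀ (by positivity), div_pow, div_le_iff₀ (by positivity)] at h
  rw [Real.rpow_def_of_pos (by positivity)]
  calc _ ≤ _ := h
    _ = _ := by ring_nf

theorem LSeriesSummable_of_norm_le_log_pow {f : ℕ → ℂ} (p : ℕ)
    (hf : ∀ n, ‖f n‖ ≤ Real.log n ^ p) {s : ℂ} (hs : 1 < s.re) : LSeriesSummable f s := by
  set η := (s.re - 1) / 2 with hη
  have hη0 : 0 < η := by rw [hη]; linarith
  refine LSeriesSummable_of_le_const_mul_rpow (x := s.re - η) (by linarith) ?_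
  refine ⟨p.factorial * (1 / η) ^ p, fun n hn => (hf n).trans ?_⟩
  refine (log_pow_le_mul_rpow p (c := 1 / η) (by positivity) hn).trans ?_
  gcongr
  · exact_mod_cast Nat.one_le_iff_ne_zero.2 hn
  · rw [one_div_one_div]; linarith

theorem abscissaOfAbsConv_le_one_of_norm_le_log_pow {f : ℕ → ℂ} (p : ℕ)
    (hf : ∀ n, ‖f n‖ ≤ Real.log n ^ p) : LSeries.abscissaOfAbsConv f ≤ 1 :=
  LSeries.abscissaOfAbsConv_le_of_forall_lt_LSeriesSummable fun _ hy =>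
    LSeriesSummable_of_norm_le_log_pow p hf (by simpa using hy)

theorem norm_twist_vonMangoldtConv_le {N : ℕ} (χ : DirichletCharacter ℂ N) (r k n : ℕ) :
    ‖χ n * (vonMangoldtConv r k n : ℂ)‖ ≤ Real.log n ^ ((r + 1) * k) := by
  rw [norm_mul, Complex.norm_real, Real.norm_of_nonneg (vonMangoldtConv_nonneg r k n)]
  exact (mul_le_of_le_one_left (vonMangoldtConv_nonneg r k n) (χ.norm_le_one _)).trans
    (vonMangoldtConv_le r k n)

theorem LSeriesSummable_twist_vonMangoldtConv {N : ℕ} (χ : DirichletCharacter ℂ N) (r k : ℕ)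
    {s : ℂ} (hs : 1 < s.re) :
    LSeriesSummable (fun n => χ n * (vonMangoldtConv r k n : ℂ)) s :=
  LSeriesSummable_of_norm_le_log_pow _ (norm_twist_vonMangoldtConv_le χ r k) hs

theorem vonMangoldtConv_one (r n : ℕ) :
    vonMangoldtConv r 1 n = ArithmeticFunction.vonMangoldt n * Real.log n ^ r := by
  rw [vonMangoldtConv_succ]
  simp only [vonMangoldtConv_zero]
  rcases eq_or_ne n 0 with rfl | hn
  · simp
  rw [Nat.sum_divisorsAntidiagonal (fun i j => ArithmeticFunction.vonMangoldt i * Real.log i ^ r *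
    if j = 1 then (1 : ℝ) else 0), Finset.sum_eq_single n]
  · simp [Nat.div_self (Nat.pos_of_ne_zero hn)]
  · intro d hd hdn
    rw [if_neg, mul_zero]
    intro h
    exact hdn (Nat.eq_of_dvd_of_div_eq_one (Nat.dvd_of_mem_divisors hd) h)
  · simp [hn]

/-- `Λ_{r,k}` is a `k`-fold Dirichlet convolution, and twisting by the completely multiplicative `χ`
distributes over convolution. -/
theorem LSeries_twist_vonMangoldtConv {N : ℕ} (χ : DirichletCharacter ℂ N) (r k : ℕ)
    {s : ℂ} (hs : 1 < s.re) :
    LSeries (fun n => χ n * (vonMangoldtConv r k n : ℂ)) s =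
      (LSeries (fun n => χ n * (vonMangoldtConv r 1 n : ℂ)) s) ^ k := by
  induction k with
  | zero =>
    rw [pow_zero, ← show LSeries LSeries.delta s = 1 from congrFun LSeries_delta s]
    refine LSeries_congr (fun {n} _ => ?_) s
    rw [vonMangoldtConv_zero]
    by_cases h : n = 1 <;> simp [h, LSeries.delta]
  | succ k ih =>
    rw [pow_succ', ← ih, ← LSeries_convolution' (LSeriesSummable_twist_vonMangoldtConv χ r 1 hs)
      (LSeriesSummable_twist_vonMangoldtConv χ r k hs)]
    congr 1
    have := χ.mul_convolution_distrib (fun n => (vonMangoldtConv r 1 n : ℂ))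
      (fun n => (vonMangoldtConv r k n : ℂ))
    refine Eq.trans ?_ this.symm
    ext n
    simp only [Pi.mul_apply, LSeries.convolution_def]
    rw [vonMangoldtConv_succ]
    simp [vonMangoldtConv_one]

/-! ### Bounds for `L(s, χ)`, linear in the modulus. -/

theorem sum_range_char_eq_zero {N : ℕ} [NeZero N] {χ : DirichletCharacter ℂ N} (hχ : χ ≠ 1)
    (t : ℕ) : ∑ i ∈ Finset.range N, χ ((t + i : ℕ) : ZMod N) = 0 := by
  rw [← MulChar.sum_eq_zero_of_ne_one hχ, ← Equiv.sum_comp (Equiv.addLeft (t : ZMod N))]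
  refine Finset.sum_nbij' (fun i => (i : ZMod N)) ZMod.val ?_ ?_ ?_ ?_ ?_
  · simp
  · intro a _; exact Finset.mem_range.2 a.val_lt
  · intro i hi; exact ZMod.val_cast_of_lt (Finset.mem_range.1 hi)
  · intro a _; exact ZMod.natCast_zmod_val a
  · intro i _; simp

theorem norm_sum_range_char_le {N : ℕ} [NeZero N] {χ : DirichletCharacter ℂ N} (hχ : χ ≠ 1)
    (t n : ℕ) : ‖∑ i ∈ Finset.range n, χ ((t + i : ℕ) : ZMod N)‖ ≤ N := by
  induction n using Nat.strong_induction_on generalizing t with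
  | _ n ih =>
    rcases lt_or_ge n N with h | h
    · calc _ ≤ ∑ i ∈ Finset.range n, (1 : ℝ) :=
            (norm_sum_le _ _).trans (Finset.sum_le_sum fun i _ => χ.norm_le_one _)
        _ ≤ N := by simpa using h.le
    · obtain ⟨q, rfl⟩ := Nat.exists_eq_add_of_le h
      rw [Finset.sum_range_add, sum_range_char_eq_zero hχ, zero_add]
      simpa only [add_assoc] using ih q (by have := NeZero.pos N; omega) (t + N)

theorem norm_sum_Icc_char_le {N : ℕ} [NeZero N] {χ : DirichletCharacter ℂ N} (hχ : χ ≠ 1)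
    (n : ℕ) : ‖∑ k ∈ Finset.Icc 1 n, χ (k : ZMod N)‖ ≤ N := by
  have : Finset.Icc 1 n = Finset.Ico 1 (n + 1) := by ext; simp
  rw [this, Finset.sum_Ico_eq_sum_range]
  exact norm_sum_range_char_le hχ 1 _

/-- The summatory function of a Dirichlet character. -/
noncomputable def charSum {N : ℕ} (χ : DirichletCharacter ℂ N) (t : ℝ) : ℂ :=
  ∑ k ∈ Finset.Icc 1 ⌊t⌋₊, χ (k : ZMod N)

theorem charSum_eq_zero {N : ℕ} (χ : DirichletCharacter ℂ N) {t : ℝ} (ht : t < 1) :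
    charSum χ t = 0 := by
  simp [charSum, Nat.floor_eq_zero.2 ht]

theorem measurable_charSum {N : ℕ} (χ : DirichletCharacter ℂ N) : Measurable (charSum χ) :=
  (measurable_from_nat (f := fun n => ∑ k ∈ Finset.Icc 1 n, χ (k : ZMod N))).comp
    Nat.measurable_floor

theorem mellin_charSum {N : ℕ} (χ : DirichletCharacter ℂ N) (s : ℂ) :
    mellin (charSum χ) (-s) =
      ∫ t : ℝ in Set.Ioi 1, (charSum χ t) * (t : ℂ) ^ (-(s + 1)) := by
  have h1 : ∫ t : ℝ in Set.Ioi 1, (charSum χ t) * (t : ℂ) ^ (-(s + 1)) =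
      ∫ t : ℝ in Set.Ici 1, (charSum χ t) * (t : ℂ) ^ (-(s + 1)) :=
    (MeasureTheory.integral_Ici_eq_integral_Ioi).symm
  rw [h1, mellin, ← MeasureTheory.setIntegral_eq_of_subset_of_forall_sdiff_eq_zero
    (s := Set.Ici (1 : ℝ)) measurableSet_Ioi (fun t (ht : (1 : ℝ) ≤ t) => Set.mem_Ioi.2 (one_pos.trans_le ht))]
  · refine MeasureTheory.setIntegral_congr_fun measurableSet_Ioi fun t _ => ?_
    simp only [smul_eq_mul]
    rw [mul_comm, neg_add']
  · intro t ht
    rw [charSum_eq_zero χ (by simpa using ht.2), zero_mul]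

/-- `charSum` is bounded at infinity, which gives the exponent 0, and vanishes near 0, where any
exponent will do. -/
theorem differentiableAt_mellin_charSum {N : ℕ} [NeZero N] {χ : DirichletCharacter ℂ N}
    (hχ : χ ≠ 1) {s : ℂ} (hs : s.re < 0) : DifferentiableAt ℂ (mellin (charSum χ)) s := by
  refine mellin_differentiableAt_of_isBigO_rpow (a := 0) (b := s.re - 1) ?_ ?_ hs ?_ (by linarith)
  · refine MeasureTheory.LocallyIntegrable.locallyIntegrableOn ?_ _
    refine (MeasureTheory.locallyIntegrable_const (N : ℝ)).mono
      (measurable_charSum χ).aestronglyMeasurable (.of_forall fun t => ?_)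
    simpa [charSum] using norm_sum_Icc_char_le hχ ⌊t⌋₊
  · refine Asymptotics.IsBigO.of_bound N (.of_forall fun t => ?_)
    simpa [charSum] using norm_sum_Icc_char_le hχ ⌊t⌋₊
  · refine Asymptotics.IsBigO.of_bound 0 ?_
    filter_upwards [nhdsWithin_le_nhds (Iio_mem_nhds one_pos)] with t ht
    simp [charSum_eq_zero χ ht]

/-- Partial summation proves this for `Re s > 1`; both sides are analytic on the connected
half-plane `Re s > 0`, so the identity theorem extends it. -/
theorem LFunction_eq_mul_mellin {N : ℕ} [NeZero N] {χ : DirichletCharacter ℂ N} (hχ : χ ≠ 1)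
    {s : ℂ} (hs : 0 < s.re) :
    DirichletCharacter.LFunction χ s = s * mellin (charSum χ) (-s) := by
  have hopen : IsOpen {s : ℂ | 0 < s.re} := isOpen_lt continuous_const Complex.continuous_re
  refine AnalyticOnNhd.eqOn_of_preconnected_of_eventuallyEq (𝕜 := ℂ) (z₀ := 2)
    (f := DirichletCharacter.LFunction χ) (U := {s : ℂ | 0 < s.re})
    (g := fun s => s * mellin (charSum χ) (-s)) ?_ ?_ ?_ (by simp) ?_ hs
  · exact fun s _ => (DirichletCharacter.differentiable_LFunction hχ).analyticAt s
  · refine DifferentiableOn.analyticOnNhd (fun s hs => ?_) hopen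
    refine (differentiableAt_id.mul ?_).differentiableWithinAt
    exact (differentiableAt_mellin_charSum hχ (by simpa using hs)).comp s differentiableAt_id.neg
  · exact (convex_halfSpace_re_gt 0).isPreconnected
  · have : {s : ℂ | 1 < s.re} ∈ 𝓝 (2 : ℂ) :=
      (isOpen_lt continuous_const Complex.continuous_re).mem_nhds (by simp)
    filter_upwards [this] with s hs
    rw [DirichletCharacter.LFunction_eq_LSeries χ hs, mellin_charSum]
    refine LSeries_eq_mul_integral _ le_rfl (one_pos.trans hs)
      (DirichletCharacter.LSeriesSummable_of_one_lt_re χ hs) ?_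
    refine Asymptotics.IsBigO.of_bound N (.of_forall fun n => ?_)
    simpa using norm_sum_Icc_char_le hχ n

theorem norm_LFunction_le {N : ℕ} [NeZero N] {χ : DirichletCharacter ℂ N} (hχ : χ ≠ 1)
    {s : ℂ} (hs : 0 < s.re) :
    ‖DirichletCharacter.LFunction χ s‖ ≤ N * (‖s‖ / s.re) := by
  rw [LFunction_eq_mul_mellin hχ hs, norm_mul, mellin_charSum]
  have hlt : -(s.re + 1) < -1 := by linarith
  have hint : ‖∫ t : ℝ in Set.Ioi 1, (charSum χ t) * (t : ℂ) ^ (-(s + 1))‖ ≤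
      ∫ t : ℝ in Set.Ioi 1, (N : ℝ) * t ^ (-(s.re + 1)) := by
    refine MeasureTheory.norm_integral_le_of_norm_le
      ((integrableOn_Ioi_rpow_of_lt hlt one_pos).const_mul _) ?_
    filter_upwards [MeasureTheory.ae_restrict_mem measurableSet_Ioi] with t ht
    rw [norm_mul, Complex.norm_cpow_eq_rpow_re_of_pos (one_pos.trans ht)]
    simp only [Complex.neg_re, Complex.add_re, Complex.one_re]
    have := Real.rpow_nonneg (one_pos.trans ht).le (-(s.re + 1))
    gcongr
    exact norm_sum_Icc_char_le hχ ⌊t⌋₊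
  rw [MeasureTheory.integral_const_mul, integral_Ioi_rpow_of_lt hlt one_pos] at hint
  refine (mul_le_mul_of_nonneg_left hint (norm_nonneg s)).trans (le_of_eq ?_)
  rw [Real.one_rpow, show -(s.re + 1) + 1 = -s.re by ring, neg_div_neg_eq]
  ring

/-- `1 / L(2, χ)` is the Dirichlet series of `χ μ` at 2, bounded by `ζ(2) ≤ 2`. -/
theorem one_le_two_mul_norm_LFunction_two {N : ℕ} [NeZero N] (χ : DirichletCharacter ℂ N) :
    1 ≤ 2 * ‖DirichletCharacter.LFunction χ 2‖ := by
  have h := DirichletCharacter.LSeries.mul_mu_eq_one χ (s := 2) (by simp)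
  rw [← DirichletCharacter.LFunction_eq_LSeries χ (by simp)] at h
  have hb : ‖LSeries ((fun n : ℕ => χ n) * fun n => (ArithmeticFunction.moebius n : ℂ)) 2‖ ≤ 2 := by
    have hz := hasSum_zeta_two
    have hpi : Real.pi ^ 2 / 6 ≤ 2 := by
      have := Real.pi_lt_d2; have := Real.pi_pos; nlinarith
    refine (tsum_of_norm_bounded hz fun n => ?_).trans hpi
    rcases eq_or_ne n 0 with rfl | hn
    · simp
    rw [LSeries.term_of_ne_zero hn, norm_div, Complex.norm_natCast_cpow_of_pos (by positivity)]
    simp only [Pi.mul_apply, Complex.re_ofNat, Real.rpow_ofNat]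
    gcongr
    rw [norm_mul, Complex.norm_intCast]
    exact mul_le_one₀ (χ.norm_le_one _) (abs_nonneg _)
      (by exact_mod_cast ArithmeticFunction.abs_moebius_le_one)
  have h' := congrArg norm h
  rw [norm_mul, norm_one] at h'
  rw [← h', mul_comm]
  gcongr

/-! ### Consequences of GRH for the logarithmic derivative. -/

theorem GeneralizedRiemannHypothesis.LFunction_ne_zero (hGRH : GeneralizedRiemannHypothesis)
    {N : ℕ} [NeZero N] {χ : DirichletCharacter ℂ N} (hχ : χ ≠ 1) {s : ℂ} (hs : 1 / 2 < s.re) :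
    DirichletCharacter.LFunction χ s ≠ 0 := by
  rcases lt_or_ge s.re 1 with h | h
  · intro h0
    have := hGRH N χ s (by linarith) h h0
    linarith
  · exact DirichletCharacter.LFunction_ne_zero_of_one_le_re χ (.inl hχ) h

theorem half_lt_re_of_mem_ball {s : ℂ} {R : ℝ} (hs : s ∈ Metric.ball (2 : ℂ) R) : 2 - R < s.re := by
  have h := (Complex.abs_re_le_norm (s - 2)).trans_lt (mem_ball_iff_norm.1 hs)
  simp only [Complex.sub_re, Complex.re_ofNat] at h
  linarith [neg_abs_le (s.re - 2)]

theorem analyticOnNhd_logDeriv (hGRH : GeneralizedRiemannHypothesis)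
    {N : ℕ} [NeZero N] {χ : DirichletCharacter ℂ N} (hχ : χ ≠ 1) :
    AnalyticOnNhd ℂ (fun s => deriv (DirichletCharacter.LFunction χ) s /
      DirichletCharacter.LFunction χ s) {s | 1 / 2 < s.re} := fun s hs =>
  have h := (DirichletCharacter.differentiable_LFunction hχ).analyticAt s
  h.deriv.div h (hGRH.LFunction_ne_zero hχ hs)

theorem analyticOnNhd_iteratedDeriv_logDeriv (hGRH : GeneralizedRiemannHypothesis) (r : ℕ)
    {N : ℕ} [NeZero N] {χ : DirichletCharacter ℂ N} (hχ : χ ≠ 1) :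
    AnalyticOnNhd ℂ (iteratedDeriv r (fun s => deriv (DirichletCharacter.LFunction χ) s /
      DirichletCharacter.LFunction χ s)) {s | 1 / 2 < s.re} := by
  rw [iteratedDeriv_eq_iterate]
  exact (analyticOnNhd_logDeriv hGRH hχ).iterated_deriv r

/-- Upper bounds for `|L|` control only the real part of `log L`; Borel–Carathéodory turns this into
a bound for its modulus, and Cauchy's estimate passes to derivatives. -/
theorem norm_iteratedDeriv_logDeriv_le (hGRH : GeneralizedRiemannHypothesis) (r : ℕ) {N : ℕ}
    [NeZero N] {χ : DirichletCharacter ℂ N} (hχ : χ ≠ 1) {s : ℂ}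
    (hs : s ∈ Metric.closedBall (2 : ℂ) (9 / 8)) :
    ‖iteratedDeriv r (fun s => deriv (DirichletCharacter.LFunction χ) s /
      DirichletCharacter.LFunction χ s) s‖ ≤ (r + 1).factorial * 240 * 8 ^ (r + 1) * N := by
  set L := DirichletCharacter.LFunction χ with hL
  have hN : (0 : ℝ) < N := by exact_mod_cast NeZero.pos N
  have hre {z : ℂ} (hz : z ∈ Metric.ball (2 : ℂ) (11 / 8)) : 5 / 8 < z.re := by
    linarith [half_lt_re_of_mem_ball hz]
  have hsub : Metric.ball (2 : ℂ) (11 / 8) ⊆ {s | 1 / 2 < s.re} := fun z hz => by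
    have := hre hz; simp only [Set.mem_ofPred_eq]; linarith
  -- `g` is a primitive of `L'/L` vanishing at 2, that is, a branch of `log (L / L(2))`.
  obtain ⟨g, hg2, hg⟩ := Complex.IsExactOn.with_val_at
    (((analyticOnNhd_logDeriv hGRH hχ).mono hsub).differentiableOn.isExactOn_ball) 2 0
  have hLdiff (z : ℂ) : HasDerivAt L (deriv L z) z :=
    (DirichletCharacter.differentiable_LFunction hχ z).hasDerivAt
  have hexp {z : ℂ} (hz : z ∈ Metric.ball (2 : ℂ) (11 / 8)) : L z = L 2 * Complex.exp (g z) := by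
    have hder {z : ℂ} (hz : z ∈ Metric.ball (2 : ℂ) (11 / 8)) :
        HasDerivAt (fun z => L z * Complex.exp (-g z)) 0 z := by
      refine ((hLdiff z).mul (hg z hz).neg.cexp).congr_deriv ?_
      have e : deriv L z / L z * L z = deriv L z :=
        div_mul_cancel₀ _ (hGRH.LFunction_ne_zero hχ (hsub hz))
      linear_combination (-Complex.exp (-g z)) * e
    have hc := Metric.isOpen_ball.is_const_of_deriv_eq_zero
      (convex_ball (2 : ℂ) (11 / 8)).isPreconnected
      (fun z hz => (hder hz).differentiableAt.differentiableWithinAt)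
      (fun z hz => (hder hz).deriv) hz (Metric.mem_ball_self (by norm_num))
    simp only [hg2, neg_zero, Complex.exp_zero, mul_one] at hc
    rw [← hc, mul_assoc, ← Complex.exp_add]
    simp
  -- On this disc `‖z‖ / Re z ≤ (27/8) / (5/8) < 6`, and `1 / |L(2)| ≤ 2`; hence the 12.
  have hre_g {z : ℂ} (hz : z ∈ Metric.ball (2 : ℂ) (11 / 8)) : (g z).re ≤ 12 * N := by
    have h1 := norm_LFunction_le hχ (s := z) (by linarith [hre hz])
    have h2 := one_le_two_mul_norm_LFunction_two χ
    have h3 : ‖z‖ / z.re ≤ 6 := by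
      have hz1 : ‖z‖ ≤ 27 / 8 := by
        calc ‖z‖ = ‖(z - 2) + 2‖ := by ring_nf
          _ ≤ ‖z - 2‖ + ‖(2 : ℂ)‖ := norm_add_le _ _
          _ ≤ 11 / 8 + 2 := by
            have := mem_ball_iff_norm.1 hz
            simp only [Complex.norm_ofNat]; linarith
          _ = 27 / 8 := by norm_num
      have := hre hz
      rw [div_le_iff₀ (by linarith)]; linarith
    rw [← hL, hexp hz, norm_mul, Complex.norm_exp] at h1
    rw [← hL] at h2
    have h4 : Real.exp (g z).re ≤ 12 * N := by
      calc Real.exp (g z).re ≤ 2 * ‖L 2‖ * Real.exp (g z).re :=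
            le_mul_of_one_le_left (Real.exp_pos _).le h2
        _ ≤ 2 * (N * 6) := by
          have : (N : ℝ) * (‖z‖ / z.re) ≤ N * 6 := by gcongr
          linarith
        _ = 12 * N := by ring
    linarith [Real.add_one_le_exp (g z).re]
  -- Borel–Carathéodory with radii `5/4 < 11/8`: `2 · 12N · (5/4) / (1/8) = 240N`.
  have hnorm_g {z : ℂ} (hz : z ∈ Metric.closedBall (2 : ℂ) (5 / 4)) : ‖g z‖ ≤ 240 * N := by
    have hzn : ‖z - 2‖ ≤ 5 / 4 := mem_closedBall_iff_norm.1 hz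
    have hmap {w : ℂ} (hw : w ∈ Metric.ball (0 : ℂ) (11 / 8)) :
        w + 2 ∈ Metric.ball (2 : ℂ) (11 / 8) := by
      simpa [mem_ball_iff_norm] using hw
    have h := Complex.borelCaratheodory_zero (f := fun w => g (w + 2)) (M := 12 * N)
      (R := 11 / 8) (z := z - 2) (by positivity) (fun w hw =>
        ((hg _ (hmap hw)).comp_add_const w 2).differentiableAt.differentiableWithinAt)
      (fun w hw => hre_g (hmap hw)) (by norm_num)
      (by rw [mem_ball_zero_iff]; linarith) (by simpa using hg2)
    simp only [sub_add_cancel] at h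
    refine h.trans ?_
    rw [div_le_iff₀ (by linarith)]
    nlinarith
  -- `9/8 + 1/8 = 5/4` leaves room for Cauchy's estimate on circles of radius `1/8`.
  have hball {z : ℂ} (hz : z ∈ Metric.closedBall s (1 / 8)) :
      z ∈ Metric.closedBall (2 : ℂ) (5 / 4) :=
    Metric.closedBall_subset_closedBall' (by linarith [Metric.mem_closedBall.1 hs]) hz
  have hball' : Metric.closedBall (2 : ℂ) (5 / 4) ⊆ Metric.ball 2 (11 / 8) :=
    Metric.closedBall_subset_ball (by norm_num)
  have hev : deriv g =ᶠ[𝓝 s] fun s => deriv L s / L s := by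
    filter_upwards [Metric.isOpen_ball.mem_nhds
      (hball' (hball (Metric.mem_closedBall_self (by norm_num))))] with z hz
    exact (hg z hz).deriv
  rw [← hev.iteratedDeriv_eq r, ← iteratedDeriv_succ']
  refine (Complex.norm_iteratedDeriv_le_of_forall_mem_sphere_norm_le (R := 1 / 8) (r + 1)
    (by norm_num) ?_ fun z hz => hnorm_g (hball (Metric.sphere_subset_closedBall hz))).trans
    (le_of_eq ?_)
  · refine DifferentiableOn.diffContOnCl fun z hz => ?_
    exact (hg z (hball' (hball (Metric.closure_ball_subset_closedBall hz)))).differentiableAt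
      |>.differentiableWithinAt
  · rw [one_div, inv_pow, div_inv_eq_mul]; ring

/-! ### Taylor expansion at 2 and truncated Dirichlet series. -/

/-- The Taylor expansion at `2` of a function bounded on a disc containing `1` in its interior. -/
theorem norm_sub_sum_taylor_le {G : ℂ → ℂ} {M : ℝ}
    (hG : DifferentiableOn ℂ G (Metric.ball 2 (5 / 4)))
    (hM : ∀ s ∈ Metric.closedBall (2 : ℂ) (9 / 8), ‖G s‖ ≤ M) (K : ℕ) :
    ‖G 1 - ∑ k ∈ Finset.range K, (k.factorial : ℂ)⁻¹ * ((-1) ^ k * iteratedDeriv k G 2)‖ ≤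
      9 * M * (8 / 9) ^ K := by
  have hT := Complex.hasSum_taylorSeries_on_ball hG (z := 1) (by
    rw [mem_ball_iff_norm]; norm_num)
  simp only [smul_eq_mul, show (1 : ℂ) - 2 = -1 by norm_num] at hT
  have hcl : Metric.closedBall (2 : ℂ) (9 / 8) ⊆ Metric.ball 2 (5 / 4) :=
    Metric.closedBall_subset_ball (by norm_num)
  -- Cauchy's estimate at radius `9/8`, evaluated at distance 1 from the centre, gives the ratio
  -- `8/9`.
  have hcoef (k : ℕ) : ‖(k.factorial : ℂ)⁻¹ * ((-1) ^ k * iteratedDeriv k G 2)‖ ≤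
      M * (8 / 9) ^ k := by
    have h := Complex.norm_iteratedDeriv_le_of_forall_mem_sphere_norm_le (c := 2) (R := 9 / 8)
      (C := M) k (by norm_num)
      ((hG.mono (Metric.closure_ball_subset_closedBall.trans hcl)).diffContOnCl)
      fun z hz => hM z (Metric.sphere_subset_closedBall hz)
    simp only [norm_mul, norm_inv, Complex.norm_natCast, norm_pow, norm_neg, norm_one, one_pow,
      one_mul]
    rw [inv_mul_le_iff₀ (by positivity)]
    refine h.trans (le_of_eq ?_)
    rw [div_eq_mul_inv, ← inv_pow]
    norm_num
    ring
  rw [← hT.tsum_eq, ← hT.summable.sum_add_tsum_nat_add K, add_sub_cancel_left]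
  have hgeo : HasSum (fun k : ℕ => M * (8 / 9 : ℝ) ^ (k + K)) (9 * M * (8 / 9) ^ K) := by
    have := (hasSum_geometric_of_lt_one (r := 8 / 9) (by norm_num) (by norm_num)).mul_left
      (M * (8 / 9 : ℝ) ^ K)
    rw [show 9 * M * (8 / 9) ^ K = M * (8 / 9) ^ K * (1 - 8 / 9)⁻¹ by ring]
    exact this.congr_fun fun k => by rw [pow_add]; ring
  exact tsum_of_norm_bounded hgeo fun k => hcoef _

theorem iterate_logMul_apply (f : ℕ → ℂ) (k n : ℕ) :
    LSeries.logMul^[k] f n = (Real.log n : ℂ) ^ k * f n := by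
  induction k with
  | zero => simp
  | succ k ih =>
    rw [Function.iterate_succ_apply', LSeries.logMul, ih, pow_succ', mul_assoc,
      Complex.natCast_log]

theorem iteratedDeriv_logDeriv_eq (r : ℕ) {N : ℕ} [NeZero N] (χ : DirichletCharacter ℂ N)
    {s : ℂ} (hs : 1 < s.re) :
    iteratedDeriv r (fun s => deriv (DirichletCharacter.LFunction χ) s /
      DirichletCharacter.LFunction χ s) s =
      (-1) ^ (r + 1) * LSeries (fun n => χ n * (vonMangoldtConv r 1 n : ℂ)) s := by
  have hev : (fun s => deriv (DirichletCharacter.LFunction χ) s /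
      DirichletCharacter.LFunction χ s) =ᶠ[𝓝 s]
      fun s => -LSeries (fun n => χ n * (vonMangoldtConv 0 1 n : ℂ)) s := by
    filter_upwards [(isOpen_lt continuous_const Complex.continuous_re).mem_nhds hs] with z hz
    have h := DirichletCharacter.LSeries_twist_vonMangoldt_eq χ hz
    rw [← DirichletCharacter.deriv_LFunction_eq_deriv_LSeries χ hz,
      ← DirichletCharacter.LFunction_eq_LSeries χ hz, neg_div] at h
    rw [eq_comm, neg_eq_iff_eq_neg, ← h]
    congr 1
    ext n
    simp [vonMangoldtConv_one]
  rw [hev.iteratedDeriv_eq r, iteratedDeriv_fun_neg, LSeries_iteratedDeriv, pow_succ]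
  · rw [mul_neg_one, neg_mul]
    congr 2
    refine LSeries_congr (fun {n} _ => ?_) s
    rw [iterate_logMul_apply, vonMangoldtConv_one, vonMangoldtConv_one]
    push_cast
    ring
  · refine (abscissaOfAbsConv_le_one_of_norm_le_log_pow _
      (norm_twist_vonMangoldtConv_le χ 0 1)).trans_lt ?_
    exact_mod_cast hs

/-- Differentiating `n^{-s}` gives `(-log n)^k`, whose sign cancels against `(1 - 2)^k`. Of the
factor `n^{-2}`, one `1/n = e^{-log n}` completes the Poisson weight and the other stays. -/
theorem hasSum_taylor_LSeries {f : ℕ → ℂ} (hf : LSeries.abscissaOfAbsConv f ≤ 1) (hf0 : f 0 = 0)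
    (K : ℕ) :
    HasSum (fun n : ℕ => f n * ((poissonWeight K (Real.log n) / n : ℝ) : ℂ))
      (∑ k ∈ Finset.range K, (k.factorial : ℂ)⁻¹ *
        ((-1) ^ k * iteratedDeriv k (LSeries f) 2)) := by
  have h2 : LSeries.abscissaOfAbsConv f < (2 : ℂ).re := hf.trans_lt (by norm_num; norm_cast)
  have hterm : ∀ k ∈ Finset.range K, HasSum (fun n : ℕ => (k.factorial : ℂ)⁻¹ *
      LSeries.term (LSeries.logMul^[k] f) 2 n)
      ((k.factorial : ℂ)⁻¹ * ((-1) ^ k * iteratedDeriv k (LSeries f) 2)) := fun k _ => by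
    rw [LSeries_iteratedDeriv k h2, ← mul_assoc ((-1) ^ k), ← mul_pow]
    norm_num
    refine HasSum.mul_left _ (Summable.hasSum ?_)
    exact LSeriesSummable_of_abscissaOfAbsConv_lt_re
      (by rwa [LSeries.absicssaOfAbsConv_logPowMul])
  refine (hasSum_sum hterm).congr_fun fun n => ?_
  rcases eq_or_ne n 0 with rfl | hn
  · simp [hf0]
  have hn' : (n : ℂ) ≠ 0 := by exact_mod_cast hn
  simp only [LSeries.term_of_ne_zero hn, iterate_logMul_apply, poissonWeight]
  rw [Real.exp_neg, Real.exp_log (by positivity)]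
  push_cast
  rw [Finset.mul_sum, Finset.sum_div, Finset.mul_sum]
  refine Finset.sum_congr rfl fun k _ => ?_
  norm_num
  field_simp

/-- Under GRH, powers of `𝓛^{(r)}(1, χ)` are approximated by smoothly truncated Dirichlet series. -/
theorem norm_logDerivLAtOne_pow_sub_le (hGRH : GeneralizedRiemannHypothesis) (r a : ℕ) :
    ∃ C : ℝ, 0 ≤ C ∧ ∀ (N : ℕ) [NeZero N] (χ : DirichletCharacter ℂ N), χ ≠ 1 → ∀ K : ℕ,
      ‖logDerivLAtOne r χ ^ a - (-1) ^ ((r + 1) * a) * ∑' n : ℕ, χ n *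
        ((vonMangoldtConv r a n * (poissonWeight K (Real.log n) / n) : ℝ) : ℂ)‖ ≤
      C * (N : ℝ) ^ a * (8 / 9) ^ K := by
  refine ⟨9 * ((r + 1).factorial * 240 * 8 ^ (r + 1)) ^ a, by positivity,
    fun N _ χ hχ K => ?_⟩
  set f : ℂ → ℂ := fun s => deriv (DirichletCharacter.LFunction χ) s /
      DirichletCharacter.LFunction χ s with hf
  have hG : DifferentiableOn ℂ (fun s => iteratedDeriv r f s ^ a) (Metric.ball 2 (5 / 4)) := by
    refine DifferentiableOn.pow (((analyticOnNhd_iteratedDeriv_logDeriv hGRH r hχ).mono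
      fun z hz => ?_).differentiableOn) a
    have := half_lt_re_of_mem_ball hz
    simp only [Set.mem_ofPred_eq]; linarith
  have hM : ∀ s ∈ Metric.closedBall (2 : ℂ) (9 / 8), ‖iteratedDeriv r f s ^ a‖ ≤
      ((r + 1).factorial * 240 * 8 ^ (r + 1) * N) ^ a := fun s hs => by
    rw [norm_pow]
    exact pow_le_pow_left₀ (norm_nonneg _) (norm_iteratedDeriv_logDeriv_le hGRH r hχ hs) a
  have hT := norm_sub_sum_taylor_le hG hM K
  have hev : (fun s => iteratedDeriv r f s ^ a) =ᶠ[𝓝 2] fun s => (-1) ^ ((r + 1) * a) *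
      LSeries (fun n => χ n * (vonMangoldtConv r a n : ℂ)) s := by
    filter_upwards [(isOpen_lt continuous_const Complex.continuous_re).mem_nhds
      (show (1 : ℝ) < (2 : ℂ).re by simp)] with z hz
    rw [iteratedDeriv_logDeriv_eq r χ hz, LSeries_twist_vonMangoldtConv χ r a hz, mul_pow, pow_mul]
  have hS := (hasSum_taylor_LSeries (abscissaOfAbsConv_le_one_of_norm_le_log_pow _
    (norm_twist_vonMangoldtConv_le χ r a)) (by simp) K).mul_left
    ((-1 : ℂ) ^ ((r + 1) * a))
  have heq : ∑ k ∈ Finset.range K, (k.factorial : ℂ)⁻¹ * ((-1) ^ k *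
      iteratedDeriv k (fun s => iteratedDeriv r f s ^ a) 2) =
      (-1) ^ ((r + 1) * a) * ∑' n : ℕ, χ n *
        ((vonMangoldtConv r a n * (poissonWeight K (Real.log n) / n) : ℝ) : ℂ) := by
    rw [← tsum_mul_left]
    refine Eq.trans ?_ (hS.tsum_eq.symm.trans (tsum_congr fun n => ?_))
    · rw [Finset.mul_sum]
      refine Finset.sum_congr rfl fun k _ => ?_
      rw [hev.iteratedDeriv_eq k, iteratedDeriv_const_mul_field]
      ring
    · push_cast; ring
  rw [heq] at hT
  refine hT.trans (le_of_eq ?_)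
  rw [mul_pow]
  ring

/-! ### Real Dirichlet series near the pole of zeta. -/

theorem LSeries_term_ofReal (f : ℕ → ℝ) {x : ℝ} (hx : x ≠ 0) (n : ℕ) :
    LSeries.term (fun n => (f n : ℂ)) x n = ((f n * (n : ℝ) ^ (-x) : ℝ) : ℂ) := by
  rcases eq_or_ne n 0 with rfl | hn
  · simp [Real.zero_rpow (neg_ne_zero.2 hx)]
  · rw [LSeries.term_of_ne_zero hn, Real.rpow_neg (by positivity)]
    push_cast [Complex.ofReal_cpow (show (0 : ℝ) ≤ n by positivity)]
    rfl

theorem LSeries_ofReal (f : ℕ → ℝ) {x : ℝ} (hx : x ≠ 0) :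
    LSeries (fun n => (f n : ℂ)) x = ((∑' n, f n * (n : ℝ) ^ (-x) : ℝ) : ℂ) := by
  rw [LSeries, Complex.ofReal_tsum]
  exact tsum_congr fun n => LSeries_term_ofReal f hx n

theorem LSeriesSummable_ofReal_iff (f : ℕ → ℝ) {x : ℝ} (hx : x ≠ 0) :
    LSeriesSummable (fun n => (f n : ℂ)) x ↔ Summable fun n : ℕ => f n * (n : ℝ) ^ (-x) := by
  rw [LSeriesSummable, ← Complex.summable_ofReal]
  exact summable_congr fun n => LSeries_term_ofReal f hx n

theorem summable_vonMangoldtConv_mul_rpow (r k : ℕ) {x : ℝ} (hx : 1 < x) :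
    Summable fun n : ℕ => vonMangoldtConv r k n * (n : ℝ) ^ (-x) := by
  rw [← LSeriesSummable_ofReal_iff _ (by linarith)]
  refine LSeriesSummable_of_norm_le_log_pow ((r + 1) * k) (fun n => ?_) (by simpa using hx)
  rw [Complex.norm_real, Real.norm_of_nonneg (vonMangoldtConv_nonneg r k n)]
  exact vonMangoldtConv_le r k n

/-- The twisted identity for the trivial character modulo 1. -/
theorem tsum_vonMangoldtConv_mul_rpow (r k : ℕ) {x : ℝ} (hx : 1 < x) :
    ∑' n : ℕ, vonMangoldtConv r k n * (n : ℝ) ^ (-x) =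
      (∑' n : ℕ, vonMangoldtConv r 1 n * (n : ℝ) ^ (-x)) ^ k := by
  have h := LSeries_twist_vonMangoldtConv (1 : DirichletCharacter ℂ 1) r k (s := x)
    (by simpa using hx)
  have h1 (n : ℕ) : (1 : DirichletCharacter ℂ 1) n = 1 :=
    MulChar.one_apply (isUnit_of_subsingleton _)
  simp only [h1, one_mul] at h
  rw [LSeries_ofReal _ (by linarith), LSeries_ofReal _ (by linarith)] at h
  exact_mod_cast h

theorem summable_natCast_rpow_neg {x : ℝ} (hx : 1 < x) : Summable fun n : ℕ => (n : ℝ) ^ (-x) :=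
  Real.summable_nat_rpow.2 (by linarith)

/-- The convolution identity `Λ * 1 = log`, in real form. -/
theorem tsum_vonMangoldt_mul_tsum_rpow {x : ℝ} (hx : 1 < x) :
    (∑' n : ℕ, vonMangoldtConv 0 1 n * (n : ℝ) ^ (-x)) * ∑' n : ℕ, (n : ℝ) ^ (-x) =
      ∑' n : ℕ, Real.log n * (n : ℝ) ^ (-x) := by
  have hx0 : x ≠ 0 := by linarith
  have hx' : 1 < (x : ℂ).re := by simpa using hx
  have h := LSeries_convolution' (ArithmeticFunction.LSeriesSummable_vonMangoldt hx')
    (LSeriesSummable_one_iff.2 hx')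
  rw [ArithmeticFunction.convolution_vonMangoldt_const_one] at h
  have e1 := LSeries_ofReal (fun n => vonMangoldtConv 0 1 n) hx0
  have e2 := LSeries_ofReal (fun _ => 1) hx0
  have e3 := LSeries_ofReal (fun n => Real.log n) hx0
  simp only [vonMangoldtConv_one, pow_zero, mul_one, one_mul, Complex.ofReal_one] at e1 e2 ⊢
  have e2' : LSeries 1 (x : ℂ) = _ := e2
  have e3' : LSeries (fun n : ℕ => Complex.log n) (x : ℂ) =
      ((∑' n : ℕ, Real.log n * (n : ℝ) ^ (-x) : ℝ) : ℂ) := by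
    simpa only [Complex.natCast_log] using e3
  rw [e1, e2', e3'] at h
  exact_mod_cast h.symm

/-- Bounds for `ζ(1 + 1 / c)` as `c → ∞`. -/
theorem eventually_tsum_rpow_bounds : ∀ᶠ c : ℝ in atTop,
    c / 2 ≤ ∑' n : ℕ, (n : ℝ) ^ (-(1 + 1 / c)) ∧ ∑' n : ℕ, (n : ℝ) ^ (-(1 + 1 / c)) ≤ 2 * c := by
  -- As `c → ∞` the point `1 + 1/c` tends to 1 from the right, where `(x - 1) ζ(x) → 1`.
  have ht : Tendsto (fun c : ℝ => 1 + 1 / c) atTop (𝓝[>] 1) := by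
    refine tendsto_nhdsWithin_iff.2 ⟨?_, ?_⟩
    · simpa using (tendsto_const_nhds (x := (1 : ℝ))).add tendsto_inv_atTop_zero
    · filter_upwards [eventually_gt_atTop 0] with c hc
      simpa using hc
  have h := tendsto_sub_mul_tsum_nat_rpow.comp ht
  filter_upwards [h.eventually (Ioo_mem_nhds (show (1 / 2 : ℝ) < 1 by norm_num) one_lt_two),
    eventually_gt_atTop 0] with c hc hc0
  simp only [Function.comp_apply, add_sub_cancel_left, one_div, ← Real.rpow_neg (Nat.cast_nonneg _)]
    at hc ⊢
  obtain ⟨h1, h2⟩ := hc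
  rw [inv_mul_eq_div, lt_div_iff₀ hc0] at h1
  rw [inv_mul_eq_div, div_lt_iff₀ hc0] at h2
  constructor <;> linarith

/-- Divide the sum of `log n · n^{-x}` by `ζ(x)`. Since `log n ≤ 2c n^{1/(2c)}`, the numerator is at
most `2c · 4c`, while `ζ(x) ≥ c/2`. -/
theorem eventually_tsum_vonMangoldt_le : ∀ᶠ c : ℝ in atTop,
    ∑' n : ℕ, vonMangoldtConv 0 1 n * (n : ℝ) ^ (-(1 + 1 / c)) ≤ 16 * c := by
  have h2 : Tendsto (fun c : ℝ => 2 * c) atTop atTop := tendsto_id.const_mul_atTop two_pos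
  filter_upwards [eventually_tsum_rpow_bounds, h2.eventually eventually_tsum_rpow_bounds,
    eventually_gt_atTop 0] with c hc hc2 hc0
  have hx : 1 < 1 + 1 / c := by simpa using hc0
  have hx2 : 1 < 1 + 1 / (2 * c) := by simpa using hc0
  have h := tsum_vonMangoldt_mul_tsum_rpow hx
  set Z := ∑' n : ℕ, (n : ℝ) ^ (-(1 + 1 / c))
  set Λ := ∑' n : ℕ, vonMangoldtConv 0 1 n * (n : ℝ) ^ (-(1 + 1 / c))
  have hΛ : 0 ≤ Λ := tsum_nonneg fun n =>
    mul_nonneg (vonMangoldtConv_nonneg 0 1 n) (Real.rpow_nonneg (Nat.cast_nonneg n) _)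
  have hle (n : ℕ) : Real.log n * (n : ℝ) ^ (-(1 + 1 / c)) ≤
      2 * c * (n : ℝ) ^ (-(1 + 1 / (2 * c))) := by
    rcases eq_or_ne n 0 with rfl | hn
    · simp only [Nat.cast_zero, Real.log_zero, zero_mul]; positivity
    have hn' : (0 : ℝ) < n := by positivity
    have h1 := log_pow_le_mul_rpow 1 (c := 2 * c) (by positivity) hn
    simp only [pow_one, Nat.factorial_one, Nat.cast_one, one_mul] at h1
    calc _ ≤ 2 * c * (n : ℝ) ^ (1 / (2 * c)) * (n : ℝ) ^ (-(1 + 1 / c)) := by gcongr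
      _ = _ := by
        rw [mul_assoc, ← Real.rpow_add hn']; congr 2; field_simp; ring
  have hs : Summable fun n : ℕ => 2 * c * (n : ℝ) ^ (-(1 + 1 / (2 * c))) :=
    (summable_natCast_rpow_neg hx2).mul_left _
  have hlog : Λ * Z ≤ 2 * c * (2 * (2 * c)) := by
    rw [h]
    refine (Summable.tsum_le_tsum hle (hs.of_nonneg_of_le (fun n =>
      mul_nonneg (Real.log_natCast_nonneg n) (Real.rpow_nonneg (Nat.cast_nonneg n) _)) hle)
      hs).trans ?_
    rw [tsum_mul_left]
    gcongr
    exact hc2.2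
  have : Λ * (c / 2) ≤ 2 * c * (2 * (2 * c)) :=
    (mul_le_mul_of_nonneg_left hc.1 hΛ).trans hlog
  nlinarith

/-! ### Sizes of the truncated coefficients and of `μ`. -/

/-- The `n`-th coefficient at `s = 1` of the smoothly truncated Dirichlet series with coefficients
`Λ_{r,k}(n)`. -/
noncomputable def truncTerm (r k K n : ℕ) : ℝ :=
  vonMangoldtConv r k n * (poissonWeight K (Real.log n) / n)

theorem truncTerm_nonneg (r k K n : ℕ) : 0 ≤ truncTerm r k K n :=
  mul_nonneg (vonMangoldtConv_nonneg r k n)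
    (div_nonneg (poissonWeight_nonneg K (Real.log_natCast_nonneg n)) (Nat.cast_nonneg n))

theorem truncTerm_le (r k : ℕ) {K : ℕ} (hK : 2 ≤ K) (n : ℕ) :
    truncTerm r k K n ≤ 4 * (vonMangoldtConv r k n * (n : ℝ) ^ (-(1 + 1 / (K : ℝ)))) := by
  rcases eq_or_ne n 0 with rfl | hn
  · simp [truncTerm]
  have hn' : (0 : ℝ) < n := by positivity
  have hc := vonMangoldtConv_nonneg r k n
  calc _ ≤ vonMangoldtConv r k n * (4 * (n : ℝ) ^ (-(1 / (K : ℝ))) / n) := by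
        unfold truncTerm; gcongr; exact poissonWeight_log_le hK hn
    _ = _ := by rw [neg_add, Real.rpow_add hn', Real.rpow_neg_one]; ring

theorem summable_truncTerm (r k : ℕ) {K : ℕ} (hK : 2 ≤ K) : Summable (truncTerm r k K) := by
  refine Summable.of_nonneg_of_le (truncTerm_nonneg r k K) (truncTerm_le r k hK)
    ((summable_vonMangoldtConv_mul_rpow r k ?_).mul_left 4)
  have : (0 : ℝ) < K := by positivity
  simpa using this

/-- Half of the decay `n ^ (-1/K)` is spent on the power of `log n`; the other half keeps the
exponent above 1. -/
theorem truncTerm_le_mul_rpow (r k : ℕ) {K : ℕ} (hK : 2 ≤ K) {n : ℕ} (hn : n ≠ 0) :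
    truncTerm r k K n ≤ 4 * (((r + 1) * k).factorial * (2 * K : ℝ) ^ ((r + 1) * k)) *
      (n : ℝ) ^ (-(1 + 1 / (2 * K : ℝ))) := by
  have hK' : (0 : ℝ) < K := by positivity
  have hn' : (0 : ℝ) < n := by positivity
  have h := (vonMangoldtConv_le r k n).trans
    (log_pow_le_mul_rpow ((r + 1) * k) (c := 2 * K) (by positivity) hn)
  calc _ ≤ _ := truncTerm_le r k hK n
    _ ≤ 4 * (((r + 1) * k).factorial * (2 * K : ℝ) ^ ((r + 1) * k) * (n : ℝ) ^ (1 / (2 * K : ℝ)) *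
        (n : ℝ) ^ (-(1 + 1 / (K : ℝ)))) := by gcongr
    _ = _ := by
      rw [mul_assoc _ ((n : ℝ) ^ (1 / (2 * K : ℝ))), ← Real.rpow_add hn',
        show 1 / (2 * K : ℝ) + -(1 + 1 / (K : ℝ)) = -(1 + 1 / (2 * K : ℝ)) by field_simp; ring]
      ring

/-- By multiplicativity it suffices to treat `k = 1`: `(log n)^r` costs `K^r`, and the von Mangoldt
sum near 1 costs one more `K`. -/
theorem eventually_tsum_truncTerm_le (r k : ℕ) : ∃ C : ℝ, 0 ≤ C ∧ ∀ᶠ K : ℕ in atTop,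
    ∑' n, truncTerm r k K n ≤ C * (K : ℝ) ^ ((r + 1) * k) := by
  refine ⟨4 * (r.factorial * 2 ^ r * 32) ^ k, by positivity, ?_⟩
  have h2 : Tendsto (fun K : ℕ => 2 * (K : ℝ)) atTop atTop :=
    tendsto_natCast_atTop_atTop.const_mul_atTop two_pos
  filter_upwards [h2.eventually eventually_tsum_vonMangoldt_le, eventually_ge_atTop 2] with K hΛ hK
  have hK' : (0 : ℝ) < K := by positivity
  have hx : 1 < 1 + 1 / (K : ℝ) := by simpa using hK'
  have hx2 : 1 < 1 + 1 / (2 * K : ℝ) := by simpa using hK'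
  have hle (n : ℕ) : vonMangoldtConv r 1 n * (n : ℝ) ^ (-(1 + 1 / (K : ℝ))) ≤
      r.factorial * (2 * K : ℝ) ^ r *
        (vonMangoldtConv 0 1 n * (n : ℝ) ^ (-(1 + 1 / (2 * K : ℝ)))) := by
    rcases eq_or_ne n 0 with rfl | hn
    · simp
    have hn' : (0 : ℝ) < n := by positivity
    have h1 := log_pow_le_mul_rpow r (c := 2 * K) (by positivity) hn
    have hv := ArithmeticFunction.vonMangoldt_nonneg (n := n)
    rw [vonMangoldtConv_one, vonMangoldtConv_one]
    calc _ ≤ ArithmeticFunction.vonMangoldt n *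
          (r.factorial * (2 * K : ℝ) ^ r * (n : ℝ) ^ (1 / (2 * K : ℝ))) *
          (n : ℝ) ^ (-(1 + 1 / (K : ℝ))) := by gcongr
      _ = ArithmeticFunction.vonMangoldt n * (r.factorial * (2 * K : ℝ) ^ r) *
          (n : ℝ) ^ (1 / (2 * K : ℝ) + -(1 + 1 / (K : ℝ))) := by rw [Real.rpow_add hn']; ring
      _ = _ := by
        rw [show 1 / (2 * K : ℝ) + -(1 + 1 / (K : ℝ)) = -(1 + 1 / (2 * K : ℝ)) by field_simp; ring]
        ring
  have hs := summable_vonMangoldtConv_mul_rpow r 1 hx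
  have h1 : ∑' n : ℕ, vonMangoldtConv r 1 n * (n : ℝ) ^ (-(1 + 1 / (K : ℝ))) ≤
      r.factorial * (2 * K : ℝ) ^ r * (16 * (2 * K)) := by
    refine (Summable.tsum_le_tsum hle hs
      ((summable_vonMangoldtConv_mul_rpow 0 1 hx2).mul_left _)).trans ?_
    rw [tsum_mul_left]
    gcongr
  calc _ ≤ ∑' n : ℕ, 4 * (vonMangoldtConv r k n * (n : ℝ) ^ (-(1 + 1 / (K : ℝ)))) :=
        Summable.tsum_le_tsum (truncTerm_le r k hK) (summable_truncTerm r k hK)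
          ((summable_vonMangoldtConv_mul_rpow r k hx).mul_left 4)
    _ ≤ 4 * (r.factorial * (2 * K : ℝ) ^ r * (16 * (2 * K))) ^ k := by
        rw [tsum_mul_left, tsum_vonMangoldtConv_mul_rpow r k hx]
        gcongr
        exact tsum_nonneg fun n =>
          mul_nonneg (vonMangoldtConv_nonneg r 1 n) (Real.rpow_nonneg (Nat.cast_nonneg n) _)
    _ = _ := by rw [pow_mul]; ring

theorem muTerm_nonneg (a b r n : ℕ) : 0 ≤ muTerm a b r n :=
  div_nonneg (mul_nonneg (vonMangoldtConv_nonneg r a n) (vonMangoldtConv_nonneg r b n))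
    (by positivity)

/-- The factor `n ^ (1/4)` anticipates the upper-tail bound for the cutoff. A second `1/4` pays for
the logarithms, leaving `-2 + 1/4 + 1/4 = -3/2`. -/
theorem muTerm_mul_rpow_le (a b r : ℕ) : ∃ C : ℝ, 0 ≤ C ∧ ∀ n : ℕ,
    muTerm a b r n * (n : ℝ) ^ (1 / 4 : ℝ) ≤ C * (n : ℝ) ^ (-(3 / 2) : ℝ) := by
  refine ⟨((r + 1) * a + (r + 1) * b).factorial * 4 ^ ((r + 1) * a + (r + 1) * b),
    by positivity, fun n => ?_⟩
  rcases eq_or_ne n 0 with rfl | hn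
  · simp [muTerm, Real.zero_rpow]
  have hn' : (0 : ℝ) < n := by positivity
  have h := log_pow_le_mul_rpow ((r + 1) * a + (r + 1) * b) (c := 4) (by norm_num) hn
  rw [pow_add (Real.log n)] at h
  have h1 : vonMangoldtConv r a n * vonMangoldtConv r b n ≤
      Real.log n ^ ((r + 1) * a) * Real.log n ^ ((r + 1) * b) :=
    mul_le_mul (vonMangoldtConv_le r a n) (vonMangoldtConv_le r b n)
      (vonMangoldtConv_nonneg r b n) (pow_nonneg (Real.log_natCast_nonneg n) _)
  rw [muTerm, div_eq_mul_inv, ← Real.rpow_natCast _ 2, ← Real.rpow_neg hn'.le, mul_assoc,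
    ← Real.rpow_add hn']
  refine (mul_le_mul_of_nonneg_right (h1.trans h) (by positivity)).trans (le_of_eq ?_)
  rw [mul_assoc _ ((n : ℝ) ^ (1 / 4 : ℝ)), ← Real.rpow_add hn']
  norm_num

theorem muTerm_le_mul_rpow (a b r n : ℕ) :
    muTerm a b r n ≤ muTerm a b r n * (n : ℝ) ^ (1 / 4 : ℝ) := by
  rcases eq_or_ne n 0 with rfl | hn
  · simp [muTerm]
  · exact le_mul_of_one_le_right (muTerm_nonneg a b r n)
      (Real.one_le_rpow (by exact_mod_cast Nat.one_le_iff_ne_zero.2 hn) (by norm_num))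

theorem summable_muTerm_mul_rpow (a b r : ℕ) :
    Summable fun n : ℕ => muTerm a b r n * (n : ℝ) ^ (1 / 4 : ℝ) := by
  obtain ⟨C, -, h⟩ := muTerm_mul_rpow_le a b r
  exact Summable.of_nonneg_of_le (fun n => mul_nonneg (muTerm_nonneg a b r n) (by positivity)) h
    ((summable_natCast_rpow_neg (by norm_num)).mul_left C)

theorem summable_muTerm (a b r : ℕ) : Summable fun n : ℕ => muTerm a b r n :=
  (summable_muTerm_mul_rpow a b r).of_nonneg_of_le (muTerm_nonneg a b r) (muTerm_le_mul_rpow a b r)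

theorem mu_eq_tsum_nat (a b r : ℕ) : mu a b r = ∑' n : ℕ, muTerm a b r n := by
  rw [mu, ← tsum_zero_pnat_eq_tsum_nat (summable_muTerm a b r)]
  simp [muTerm]

theorem truncTerm_mul_le (a b r K n : ℕ) :
    truncTerm r a K n * truncTerm r b K n ≤ muTerm a b r n := by
  have h0 := poissonWeight_nonneg K (Real.log_natCast_nonneg n)
  have h1 := poissonWeight_le_one K (Real.log_natCast_nonneg n)
  calc _ = muTerm a b r n * (poissonWeight K (Real.log n) * poissonWeight K (Real.log n)) := by
        unfold truncTerm muTerm; ring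
    _ ≤ muTerm a b r n * 1 := by
        gcongr
        · exact muTerm_nonneg a b r n
        · exact mul_le_one₀ h1 h0 h1
    _ = _ := mul_one _

theorem summable_truncTerm_mul (a b r K : ℕ) :
    Summable fun n => truncTerm r a K n * truncTerm r b K n :=
  (summable_muTerm a b r).of_nonneg_of_le
    (fun n => mul_nonneg (truncTerm_nonneg r a K n) (truncTerm_nonneg r b K n))
    (truncTerm_mul_le a b r K)

theorem abs_tsum_truncTerm_mul_sub_mu_le (a b r K : ℕ) :
    |∑' n, truncTerm r a K n * truncTerm r b K n - mu a b r| ≤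
      2 * (∑' n : ℕ, muTerm a b r n * (n : ℝ) ^ (1 / 4 : ℝ)) * (4 / 5) ^ K := by
  have hle (n : ℕ) : muTerm a b r n - truncTerm r a K n * truncTerm r b K n ≤
      2 * (4 / 5) ^ K * (muTerm a b r n * (n : ℝ) ^ (1 / 4 : ℝ)) := by
    rcases eq_or_ne n 0 with rfl | hn
    · simp [muTerm, truncTerm]
    have h0 := poissonWeight_nonneg K (Real.log_natCast_nonneg n)
    have h1 := poissonWeight_le_one K (Real.log_natCast_nonneg n)
    have h2 := one_sub_poissonWeight_log_le K hn
    have hm := muTerm_nonneg a b r n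
    set w := poissonWeight K (Real.log n) with hw
    -- With `w` in `[0, 1]`, `1 - w² ≤ 2 (1 - w)`.
    calc _ = muTerm a b r n * (1 - w * w) := by unfold truncTerm muTerm; rw [← hw]; ring
      _ ≤ muTerm a b r n * (2 * ((4 / 5) ^ K * (n : ℝ) ^ (1 / 4 : ℝ))) := by
          gcongr; nlinarith
      _ = _ := by ring
  rw [mu_eq_tsum_nat, abs_sub_comm,
    ← (summable_muTerm a b r).tsum_sub (summable_truncTerm_mul a b r K),
    abs_of_nonneg (tsum_nonneg fun n => sub_nonneg.2 (truncTerm_mul_le a b r K n))]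
  refine (Summable.tsum_le_tsum hle ((summable_muTerm a b r).sub (summable_truncTerm_mul a b r K))
    ((summable_muTerm_mul_rpow a b r).mul_left _)).trans (le_of_eq ?_)
  rw [tsum_mul_left]; ring

/-! ### Orthogonality and sums over congruent pairs. -/

open scoped Classical in
/-- Orthogonality of characters in bilinear form. -/
theorem sum_char_mul_star_char {m : ℕ} [NeZero m] (x y : ZMod m) :
    ∑ χ : DirichletCharacter ℂ m, χ x * starRingEnd ℂ (χ y) =
      if IsUnit x ∧ x = y then (m.totient : ℂ) else 0 := by
  by_cases hy : IsUnit y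
  · have h := DirichletCharacter.sum_char_inv_mul_char_eq ℂ hy x
    have h1 (χ : DirichletCharacter ℂ m) : χ x * starRingEnd ℂ (χ y) = χ y⁻¹ * χ x := by
      rw [mul_comm]
      congr 1
      have h2 := MulChar.star_apply' χ y
      rw [show starRingEnd ℂ (χ y) = star (χ y) from rfl, h2]
      obtain ⟨u, rfl⟩ := hy
      rw [MulChar.inv_apply, Ring.inverse_unit, ZMod.inv_coe_unit]
    simp only [h1, h]
    by_cases hxy : y = x
    · subst hxy; simp [hy]
    · simp [hxy, Ne.symm hxy]
  · have : ¬ (IsUnit x ∧ x = y) := fun ⟨h, e⟩ => hy (e ▸ h)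
    rw [if_neg this]
    exact Finset.sum_eq_zero fun χ _ => by rw [MulChar.map_nonunit χ hy]; simp

theorem summable_char_mul {m : ℕ} (χ : DirichletCharacter ℂ m) {α : ℕ → ℝ} (hα : Summable α)
    (h0 : ∀ n, 0 ≤ α n) : Summable fun n : ℕ => ‖χ n * (α n : ℂ)‖ :=
  hα.of_nonneg_of_le (fun _ => norm_nonneg _) fun n => by
    rw [norm_mul, Complex.norm_real, Real.norm_of_nonneg (h0 n)]
    exact mul_le_of_le_one_left (h0 n) (χ.norm_le_one _)

theorem norm_tsum_char_mul_le {m : ℕ} (χ : DirichletCharacter ℂ m) {α : ℕ → ℝ} (hα : Summable α)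
    (h0 : ∀ n, 0 ≤ α n) : ‖∑' n : ℕ, χ n * (α n : ℂ)‖ ≤ ∑' n, α n :=
  tsum_of_norm_bounded hα.hasSum fun n => by
    rw [norm_mul, Complex.norm_real, Real.norm_of_nonneg (h0 n)]
    exact mul_le_of_le_one_left (h0 n) (χ.norm_le_one _)

open scoped Classical in
theorem sum_char_tsum_mul_star_tsum {m : ℕ} [NeZero m] {α β : ℕ → ℝ} (hα : Summable α)
    (hβ : Summable β) (hα0 : ∀ n, 0 ≤ α n) (hβ0 : ∀ n, 0 ≤ β n) :
    ∑ χ : DirichletCharacter ℂ m,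
      (∑' n : ℕ, χ n * (α n : ℂ)) * starRingEnd ℂ (∑' n : ℕ, χ n * (β n : ℂ)) =
      m.totient * ((∑' p : ℕ × ℕ, if IsUnit (p.1 : ZMod m) ∧ (p.1 : ZMod m) = p.2 then
        α p.1 * β p.2 else 0 : ℝ) : ℂ) := by
  have hstar (χ : DirichletCharacter ℂ m) : Summable fun n : ℕ =>
      ‖starRingEnd ℂ (χ n * (β n : ℂ))‖ := by
    simpa using summable_char_mul χ hβ hβ0
  have hprod (χ : DirichletCharacter ℂ m) :
      (∑' n : ℕ, χ n * (α n : ℂ)) * starRingEnd ℂ (∑' n : ℕ, χ n * (β n : ℂ)) =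
      ∑' p : ℕ × ℕ, (χ p.1 * (α p.1 : ℂ)) * starRingEnd ℂ (χ p.2 * (β p.2 : ℂ)) := by
    rw [Complex.conj_tsum, tsum_mul_tsum_of_summable_norm (summable_char_mul χ hα hα0) (hstar χ)]
  simp only [hprod]
  rw [← Summable.tsum_finsetSum fun χ _ =>
    summable_mul_of_summable_norm (summable_char_mul χ hα hα0) (hstar χ),
    Complex.ofReal_tsum, ← tsum_mul_left]
  refine tsum_congr fun p => ?_
  have h (χ : DirichletCharacter ℂ m) :
      (χ p.1 * (α p.1 : ℂ)) * starRingEnd ℂ (χ p.2 * (β p.2 : ℂ)) =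
      (χ p.1 * starRingEnd ℂ (χ p.2)) * (α p.1 * β p.2 : ℂ) := by
    rw [map_mul, Complex.conj_ofReal]; ring
  simp only [h]
  rw [← Finset.sum_mul, sum_char_mul_star_char]
  split_ifs <;> simp

/-- Such `j` are `i + m(k + 1) ≥ m(k + 1)`. The strict inequality excludes `j = i`, so every term
gains `m^{-x} ≤ 1/m`, uniformly in `i`. -/
theorem tsum_progression_le {m : ℕ} [NeZero m] {β : ℕ → ℝ} {D x : ℝ}
    (hx : 1 < x) (hβ : ∀ n, n ≠ 0 → β n ≤ D * (n : ℝ) ^ (-x)) (hD : 0 ≤ D) (hβ0 : ∀ n, 0 ≤ β n)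
    (i : ℕ) :
    ∑' j : ℕ, (if i < j ∧ (i : ZMod m) = j then β j else 0) ≤
      D * (∑' n : ℕ, (n : ℝ) ^ (-x)) / m := by
  have hm : (0 : ℝ) < m := by exact_mod_cast NeZero.pos m
  have hm1 : (1 : ℝ) ≤ m := by exact_mod_cast NeZero.one_le
  have hinj : Function.Injective fun k : ℕ => i + m * (k + 1) := fun k l h => by
    have := NeZero.pos m
    simpa [this.ne'] using h
  have hsupp : Function.support (fun j : ℕ => if i < j ∧ (i : ZMod m) = j then β j else 0) ⊆
      Set.range fun k : ℕ => i + m * (k + 1) := by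
    intro j hj
    have hj' : i < j ∧ (i : ZMod m) = j := by
      by_contra h
      exact hj (if_neg h)
    obtain ⟨c, hc⟩ := (Nat.modEq_iff_dvd' hj'.1.le).1 ((ZMod.natCast_eq_natCast_iff _ _ _).1 hj'.2)
    have hc0 : c ≠ 0 := by
      rintro rfl
      omega
    refine ⟨c - 1, ?_⟩
    simp only
    rw [Nat.sub_add_cancel (Nat.one_le_iff_ne_zero.2 hc0), ← hc]
    omega
  have hs : Summable fun n : ℕ => (n : ℝ) ^ (-x) := Real.summable_nat_rpow.2 (by linarith)
  have hs1 : Summable fun k : ℕ => ((k + 1 : ℕ) : ℝ) ^ (-x) := (summable_nat_add_iff 1).2 hs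
  have hterm (k : ℕ) : (if i < i + m * (k + 1) ∧ (i : ZMod m) = (i + m * (k + 1) : ℕ) then
      β (i + m * (k + 1)) else 0) ≤ D / m * ((k + 1 : ℕ) : ℝ) ^ (-x) := by
    have hb : β (i + m * (k + 1)) ≤ D / m * ((k + 1 : ℕ) : ℝ) ^ (-x) := by
      have hpos : 0 < m * (k + 1) := Nat.mul_pos (NeZero.pos m) k.succ_pos
      refine (hβ _ (by omega)).trans ?_
      rw [div_mul_eq_mul_div, mul_div_assoc]
      gcongr
      have h1 : ((i + m * (k + 1) : ℕ) : ℝ) ^ (-x) ≤ ((m * (k + 1) : ℕ) : ℝ) ^ (-x) :=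
        Real.rpow_le_rpow_of_nonpos (by exact_mod_cast hpos)
          (by exact_mod_cast Nat.le_add_left _ _) (by linarith)
      refine h1.trans ?_
      rw [Nat.cast_mul, Real.mul_rpow hm.le (by positivity), div_eq_mul_inv, mul_comm]
      gcongr
      rw [← Real.rpow_neg_one]
      exact Real.rpow_le_rpow_of_exponent_le hm1 (by linarith)
    split_ifs
    · exact hb
    · positivity
  rw [← hinj.tsum_eq hsupp]
  have hsD := hs1.mul_left (D / m)
  refine (Summable.tsum_le_tsum hterm (hsD.of_nonneg_of_le (fun k => ?_) hterm) hsD).trans ?_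
  · split_ifs
    · exact hβ0 _
    · exact le_rfl
  · rw [tsum_mul_left, div_mul_eq_mul_div, hs.tsum_eq_zero_add]
    gcongr
    simpa using Real.rpow_nonneg (le_refl (0 : ℝ)) (-x)

theorem summable_ite_mul {α β : ℕ → ℝ} (hα : Summable α) (hβ : Summable β) (hα0 : ∀ n, 0 ≤ α n)
    (hβ0 : ∀ n, 0 ≤ β n) (P : ℕ × ℕ → Prop) [DecidablePred P] :
    Summable fun p : ℕ × ℕ => if P p then α p.1 * β p.2 else 0 := by
  have h : Summable fun p : ℕ × ℕ => α p.1 * β p.2 := hα.mul_of_nonneg hβ hα0 hβ0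
  refine h.of_nonneg_of_le (fun p => ?_) fun p => ?_
  · have := mul_nonneg (hα0 p.1) (hβ0 p.2)
    split_ifs <;> simp [this]
  · have := mul_nonneg (hα0 p.1) (hβ0 p.2)
    split_ifs <;> simp [this]

theorem tsum_lt_congruent_le {m : ℕ} [NeZero m] {α β : ℕ → ℝ} {D x : ℝ} (hα : Summable α)
    (hβs : Summable β) (hα0 : ∀ n, 0 ≤ α n) (hx : 1 < x)
    (hβ : ∀ n, n ≠ 0 → β n ≤ D * (n : ℝ) ^ (-x)) (hD : 0 ≤ D) (hβ0 : ∀ n, 0 ≤ β n) :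
    ∑' p : ℕ × ℕ, (if p.1 < p.2 ∧ (p.1 : ZMod m) = p.2 then α p.1 * β p.2 else 0) ≤
      (∑' n, α n) * (D * (∑' n : ℕ, (n : ℝ) ^ (-x)) / m) := by
  have hs := summable_ite_mul hα hβs hα0 hβ0 (fun p => p.1 < p.2 ∧ (p.1 : ZMod m) = p.2)
  have hin (i : ℕ) : ∑' j : ℕ, (if i < j ∧ (i : ZMod m) = j then α i * β j else 0) ≤
      α i * (D * (∑' n : ℕ, (n : ℝ) ^ (-x)) / m) := by
    simp only [← mul_ite_zero]
    rw [tsum_mul_left]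
    exact mul_le_mul_of_nonneg_left (tsum_progression_le hx hβ hD hβ0 i) (hα0 i)
  rw [hs.tsum_prod, ← tsum_mul_right]
  exact Summable.tsum_le_tsum hin hs.prod (hα.mul_right _)

/-- The bilinear mean over congruent pairs is close to the diagonal sum. -/
theorem abs_tsum_congruent_sub_diag_le {m : ℕ} [NeZero m] (hm : m.Prime) {α β : ℕ → ℝ} {D E x : ℝ}
    (hα : Summable α) (hβ : Summable β) (hα0 : ∀ n, 0 ≤ α n) (hβ0 : ∀ n, 0 ≤ β n) (hx : 1 < x)
    (hD : 0 ≤ D) (hE : 0 ≤ E) (hαD : ∀ n, n ≠ 0 → α n ≤ D * (n : ℝ) ^ (-x))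
    (hβE : ∀ n, n ≠ 0 → β n ≤ E * (n : ℝ) ^ (-x))
    [DecidablePred fun p : ℕ × ℕ =>
      IsUnit (p.1 : ZMod m) ∧ (p.1 : ZMod m) = p.2] :
    |(∑' p : ℕ × ℕ, if IsUnit (p.1 : ZMod m) ∧ (p.1 : ZMod m) = p.2 then
        α p.1 * β p.2 else 0) - ∑' n, α n * β n| ≤
      ((∑' n, α n) * E + (∑' n, β n) * D) * (∑' n : ℕ, (n : ℝ) ^ (-x)) / m +
        ∑' n, (if m ∣ n then α n * β n else 0) := by
  have hdinj : Function.Injective fun n : ℕ => (n, n) := fun a b h => (Prod.mk.inj h).1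
  have hd (P : ℕ → Prop) [DecidablePred P] :
      ∑' p : ℕ × ℕ, (if p.1 = p.2 ∧ P p.1 then α p.1 * β p.2 else 0) =
      ∑' n, if P n then α n * β n else 0 := by
    rw [← hdinj.tsum_eq]
    · simp
    · intro p hp
      have : p.1 = p.2 := by
        by_contra h
        exact hp (if_neg fun h' => h h'.1)
      exact ⟨p.1, Prod.ext rfl this⟩
  have h1 : ∑' n, α n * β n =
      ∑' p : ℕ × ℕ, (if p.1 = p.2 ∧ True then α p.1 * β p.2 else 0) := by
    rw [hd fun _ => True]; simp
  have sI := summable_ite_mul hα hβ hα0 hβ0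
    (fun p => IsUnit (p.1 : ZMod m) ∧ (p.1 : ZMod m) = p.2)
  have sD := summable_ite_mul hα hβ hα0 hβ0 (fun p => p.1 = p.2 ∧ True)
  have sL := summable_ite_mul hα hβ hα0 hβ0 (fun p => p.1 < p.2 ∧ (p.1 : ZMod m) = p.2)
  have sG := summable_ite_mul hα hβ hα0 hβ0 (fun p => p.2 < p.1 ∧ (p.2 : ZMod m) = p.1)
  have sM := summable_ite_mul hα hβ hα0 hβ0 (fun p => p.1 = p.2 ∧ m ∣ p.1)
  -- The two indicators differ only on unequal congruent pairs, on either side of the diagonal, and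
  -- on diagonal entries divisible by the prime `m`.
  have hpt (p : ℕ × ℕ) :
      ‖(if IsUnit (p.1 : ZMod m) ∧ (p.1 : ZMod m) = p.2 then α p.1 * β p.2 else 0) -
        (if p.1 = p.2 ∧ True then α p.1 * β p.2 else 0)‖ ≤
      (if p.1 < p.2 ∧ (p.1 : ZMod m) = p.2 then α p.1 * β p.2 else 0) +
      (if p.2 < p.1 ∧ (p.2 : ZMod m) = p.1 then α p.1 * β p.2 else 0) +
      (if p.1 = p.2 ∧ m ∣ p.1 then α p.1 * β p.2 else 0) := by
    obtain ⟨i, j⟩ := p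
    have h0 : 0 ≤ α i * β j := mul_nonneg (hα0 i) (hβ0 j)
    have h0' : |α i| * |β j| = α i * β j := by rw [abs_of_nonneg (hα0 i), abs_of_nonneg (hβ0 j)]
    have hu : ¬ m ∣ i → IsUnit (i : ZMod m) := fun h =>
      (ZMod.isUnit_iff_coprime i m).2 ((hm.coprime_iff_not_dvd.2 h).symm)
    simp only [and_true]
    rcases lt_trichotomy i j with h | h | h
    · by_cases hc : (i : ZMod m) = j
      · simp only [hc, and_true, h, h.ne, h.not_gt, if_true, if_false, false_and]
        split_ifs <;> simp [h0', h0]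
      · simp [hc, h.ne, h.not_gt]
    · subst h
      by_cases hdv : m ∣ i
      · simp only [hdv, and_true, lt_irrefl, if_false, if_true]
        split_ifs <;> simp [h0', h0]
      · simp [hu hdv, hdv]
    · by_cases hc : (j : ZMod m) = i
      · simp only [hc, and_true, h, h.ne', h.not_gt, if_true, if_false, false_and]
        split_ifs <;> simp [h0', h0]
      · simp [hc, Ne.symm hc, h.ne', h.not_gt]
  have hswap : ∑' p : ℕ × ℕ, (if p.2 < p.1 ∧ (p.2 : ZMod m) = p.1 then α p.1 * β p.2 else 0) =
      ∑' p : ℕ × ℕ, (if p.1 < p.2 ∧ (p.1 : ZMod m) = p.2 then β p.1 * α p.2 else 0) := by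
    rw [← (Equiv.prodComm ℕ ℕ).tsum_eq]
    refine tsum_congr fun p => ?_
    by_cases hp : p.1 < p.2 ∧ (p.1 : ZMod m) = p.2 <;> simp [hp, mul_comm]
  rw [h1, ← sI.tsum_sub sD, ← Real.norm_eq_abs]
  refine (tsum_of_norm_bounded ((sL.add sG).add sM).hasSum hpt).trans ?_
  rw [(sL.add sG).tsum_add sM, sL.tsum_add sG, hswap, hd fun n => m ∣ n]
  have b1 := tsum_lt_congruent_le (m := m) hα hβ hα0 hx hβE hE hβ0
  have b2 := tsum_lt_congruent_le (m := m) hβ hα hβ0 hx hαD hD hα0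
  calc _ ≤ (∑' n, α n) * (E * (∑' n : ℕ, (n : ℝ) ^ (-x)) / m) +
        (∑' n, β n) * (D * (∑' n : ℕ, (n : ℝ) ^ (-x)) / m) +
        ∑' n, (if m ∣ n then α n * β n else 0) := by gcongr
    _ = _ := by ring

theorem tsum_dvd_le {m : ℕ} [NeZero m] {f : ℕ → ℝ} {C x : ℝ} (hf0 : ∀ n, 0 ≤ f n) (hC : 0 ≤ C)
    (hx : 1 < x) (hf : ∀ n, f n ≤ C * (n : ℝ) ^ (-x)) :
    ∑' n, (if m ∣ n then f n else 0) ≤ C * (∑' n : ℕ, (n : ℝ) ^ (-x)) / m := by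
  have hm : (0 : ℝ) < m := by exact_mod_cast NeZero.pos m
  have hm1 : (1 : ℝ) ≤ m := by exact_mod_cast NeZero.one_le
  have hinj : Function.Injective fun k : ℕ => m * k :=
    fun k l h => Nat.eq_of_mul_eq_mul_left (NeZero.pos m) h
  rw [← hinj.tsum_eq (fun n hn => by
    by_contra h
    exact hn (if_neg fun ⟨k, hk⟩ => h ⟨k, hk.symm⟩))]
  simp only [dvd_mul_right, if_true]
  have hle (k : ℕ) : f (m * k) ≤ C / m * (k : ℝ) ^ (-x) := by
    refine (hf _).trans ?_
    rw [Nat.cast_mul, Real.mul_rpow hm.le (by positivity), div_eq_mul_inv, mul_assoc]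
    gcongr
    rw [← Real.rpow_neg_one]
    exact Real.rpow_le_rpow_of_exponent_le hm1 (by linarith)
  have hs : Summable fun n : ℕ => C / m * (n : ℝ) ^ (-x) :=
    (Real.summable_nat_rpow.2 (by linarith)).mul_left _
  refine (Summable.tsum_le_tsum hle (hs.of_nonneg_of_le (fun k => hf0 _) hle) hs).trans
    (le_of_eq ?_)
  rw [tsum_mul_left]; ring

/-! ### Mean values and assembly. -/

/-- The character mean of the truncated Dirichlet series. -/
theorem truncated_mean (r a b : ℕ) : ∃ C : ℝ, 0 ≤ C ∧ ∀ᶠ K : ℕ in atTop,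
    ∀ (m : ℕ) [NeZero m], m.Prime →
      ‖∑ χ : DirichletCharacter ℂ m, (∑' n : ℕ, χ n * (truncTerm r a K n : ℂ)) *
          starRingEnd ℂ (∑' n : ℕ, χ n * (truncTerm r b K n : ℂ)) - m.totient * (mu a b r : ℂ)‖ ≤
        m.totient * (C * ((K : ℝ) ^ ((r + 1) * (a + b) + 1) / m + (4 / 5) ^ K)) := by
  classical
  obtain ⟨A, hA, hAe⟩ := eventually_tsum_truncTerm_le r a
  obtain ⟨B, hB, hBe⟩ := eventually_tsum_truncTerm_le r b
  obtain ⟨M, hM, hMle⟩ := muTerm_mul_rpow_le a b r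
  set D : ℝ := 4 * (((r + 1) * a).factorial * 2 ^ ((r + 1) * a)) with hD
  set E : ℝ := 4 * (((r + 1) * b).factorial * 2 ^ ((r + 1) * b)) with hE
  set W := ∑' n : ℕ, muTerm a b r n * (n : ℝ) ^ (1 / 4 : ℝ) with hW
  set Y := ∑' n : ℕ, (n : ℝ) ^ (-(3 / 2) : ℝ) with hY
  have hD0 : 0 ≤ D := by positivity
  have hE0 : 0 ≤ E := by positivity
  have hW0 : 0 ≤ W := tsum_nonneg fun n => mul_nonneg (muTerm_nonneg a b r n) (by positivity)
  have hY0 : 0 ≤ Y := tsum_nonneg fun n => by positivity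
  refine ⟨(A * E + B * D) * 4 + M * Y + 2 * W, by positivity, ?_⟩
  have h2 : Tendsto (fun K : ℕ => 2 * (K : ℝ)) atTop atTop :=
    tendsto_natCast_atTop_atTop.const_mul_atTop two_pos
  filter_upwards [hAe, hBe, h2.eventually eventually_tsum_rpow_bounds, eventually_ge_atTop 2]
    with K hAK hBK hZ hK m _ hm
  have hm0 : (0 : ℝ) < m := by exact_mod_cast hm.pos
  have hK0 : (0 : ℝ) < K := by positivity
  have hK1 : (1 : ℝ) ≤ K := by exact_mod_cast (by omega : 1 ≤ K)
  have hx : 1 < 1 + 1 / (2 * K : ℝ) := by simpa using hK0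
  have sα := summable_truncTerm r a hK
  have sβ := summable_truncTerm r b hK
  rw [sum_char_tsum_mul_star_tsum sα sβ (truncTerm_nonneg r a K) (truncTerm_nonneg r b K),
    ← mul_sub, norm_mul, Complex.norm_natCast, ← Complex.ofReal_sub, Complex.norm_real,
    Real.norm_eq_abs]
  refine mul_le_mul_of_nonneg_left ?_ (Nat.cast_nonneg _)
  have h1 := abs_tsum_congruent_sub_diag_le hm sα sβ (truncTerm_nonneg r a K)
    (truncTerm_nonneg r b K) hx (D := D * (K : ℝ) ^ ((r + 1) * a))
    (E := E * (K : ℝ) ^ ((r + 1) * b)) (by positivity) (by positivity)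
    (fun n hn => (truncTerm_le_mul_rpow r a hK hn).trans
      (le_of_eq (by rw [hD, mul_pow]; ring)))
    (fun n hn => (truncTerm_le_mul_rpow r b hK hn).trans
      (le_of_eq (by rw [hE, mul_pow]; ring)))
  have h3 := abs_tsum_truncTerm_mul_sub_mu_le a b r K
  have h4 := tsum_dvd_le (m := m) (f := fun n => truncTerm r a K n * truncTerm r b K n)
    (fun n => mul_nonneg (truncTerm_nonneg r a K n) (truncTerm_nonneg r b K n)) hM
    (x := 3 / 2) (by norm_num)
    (fun n => (truncTerm_mul_le a b r K n).trans ((muTerm_le_mul_rpow a b r n).trans (hMle n)))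
  set Z := ∑' n : ℕ, (n : ℝ) ^ (-(1 + 1 / (2 * K : ℝ))) with hZdef
  set P : ℝ := (K : ℝ) ^ ((r + 1) * (a + b) + 1) with hP
  have hP1 : 1 ≤ P := one_le_pow₀ hK1
  have hZ0 : 0 ≤ Z := tsum_nonneg fun n => by positivity
  -- The extra power of `K` in `P` comes from `ζ(1 + 1/(2K)) ≤ 4K`.
  have h5 : ((∑' n, truncTerm r a K n) * (E * (K : ℝ) ^ ((r + 1) * b)) +
      (∑' n, truncTerm r b K n) * (D * (K : ℝ) ^ ((r + 1) * a))) * Z / m ≤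
      (A * E + B * D) * 4 * (P / m) := by
    calc _ ≤ ((A * (K : ℝ) ^ ((r + 1) * a)) * (E * (K : ℝ) ^ ((r + 1) * b)) +
          (B * (K : ℝ) ^ ((r + 1) * b)) * (D * (K : ℝ) ^ ((r + 1) * a))) * (2 * (2 * K)) / m := by
          gcongr
          exact hZ.2
      _ = _ := by rw [hP, mul_add, pow_succ, pow_add]; ring
  have h6 : M * Y / m ≤ M * Y * (P / m) := by
    rw [← mul_one_div]
    gcongr
  refine (abs_sub_le _ (∑' n, truncTerm r a K n * truncTerm r b K n) _).trans ?_
  have h8 : 0 ≤ P / m := by positivity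
  have h9 : (0 : ℝ) ≤ (4 / 5) ^ K := by positivity
  have e1 : 0 ≤ 2 * W * (P / m) := by positivity
  have e2 : 0 ≤ ((A * E + B * D) * 4 + M * Y) * (4 / 5) ^ K := by positivity
  nlinarith

/-- From `1 - 1/c ≤ e^{-1/c}`: a multiple of `log x` as exponent beats any prescribed power of `x`.
-/
theorem geometric_le_inv {q c x : ℝ} {K : ℕ} (hq : 0 ≤ q) (hqc : q ≤ 1 - 1 / c) (hc : 0 < c)
    (hx : 0 < x) (d : ℕ) (hK : c * d * Real.log x ≤ K) : q ^ K ≤ (x ^ d)⁻¹ := by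
  have h1 : q ≤ Real.exp (-(1 / c)) := hqc.trans (by linarith [Real.add_one_le_exp (-(1 / c))])
  calc q ^ K ≤ Real.exp (-(1 / c)) ^ K := pow_le_pow_left₀ hq h1 K
    _ = Real.exp (-(K / c)) := by rw [← Real.exp_nat_mul]; ring_nf
    _ ≤ Real.exp (-(d * Real.log x)) := by
        gcongr
        rw [le_div_iff₀ hc]; linarith
    _ = _ := by rw [Real.exp_neg, Real.exp_nat_mul, Real.exp_log hx]

theorem norm_mul_star_sub_le (z w u v : ℂ) {e f S T : ℝ} (hz : ‖z - u‖ ≤ e) (hw : ‖w - v‖ ≤ f)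
    (hu : ‖u‖ ≤ S) (hv : ‖v‖ ≤ T) :
    ‖z * starRingEnd ℂ w - u * starRingEnd ℂ v‖ ≤ e * (T + f) + S * f := by
  have h : z * starRingEnd ℂ w - u * starRingEnd ℂ v =
      (z - u) * (starRingEnd ℂ v + starRingEnd ℂ (w - v)) + u * starRingEnd ℂ (w - v) := by
    rw [map_sub]; ring
  have he : 0 ≤ e := (norm_nonneg _).trans hz
  have hS : 0 ≤ S := (norm_nonneg _).trans hu
  rw [h]
  refine (norm_add_le _ _).trans ?_
  rw [norm_mul, norm_mul]
  gcongr
  · refine (norm_add_le _ _).trans ?_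
    rw [RCLike.norm_conj, RCLike.norm_conj]
    gcongr
  · rwa [RCLike.norm_conj]

theorem card_nonprincipalChars {m : ℕ} [NeZero m] (hm : m.Prime) :
    ((nonprincipalChars m).card : ℝ) = m - 2 := by
  classical
  have h1 : (nonprincipalChars m).card + 1 = m - 1 := by
    have hc := DirichletCharacter.card_eq_totient_of_hasEnoughRootsOfUnity ℂ m
    rw [Nat.totient_prime hm, Nat.card_eq_fintype_card] at hc
    rw [← hc, nonprincipalChars, Finset.filter_ne', Finset.card_erase_of_mem (Finset.mem_univ _),
      Finset.card_univ, Nat.sub_add_cancel Fintype.card_pos]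
  have := hm.two_le
  have h2 : (nonprincipalChars m).card = m - 2 := by omega
  rw [h2, Nat.cast_sub this]
  norm_num

/-- The moment bound in terms of the truncation parameter. -/
theorem moment_sub_le (hGRH : GeneralizedRiemannHypothesis) (r a b : ℕ) :
    ∃ C : ℝ, 0 ≤ C ∧ ∀ᶠ K : ℕ in atTop, ∀ (m : ℕ) [NeZero m], m.Prime → 3 ≤ m →
      9 * ((a + b + 1 : ℕ) : ℝ) * Real.log m ≤ K →
      ‖moment m r a b - (-1 : ℂ) ^ ((r + 1) * (a + b)) * (mu a b r : ℂ)‖ ≤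
        C * ((K : ℝ) ^ ((r + 1) * (a + b) + 1) / m) := by
  classical
  obtain ⟨A, hA, hAe⟩ := eventually_tsum_truncTerm_le r a
  obtain ⟨B, hB, hBe⟩ := eventually_tsum_truncTerm_le r b
  obtain ⟨F, hF, hFe⟩ := norm_logDerivLAtOne_pow_sub_le hGRH r a
  obtain ⟨G, hG, hGe⟩ := norm_logDerivLAtOne_pow_sub_le hGRH r b
  obtain ⟨T, hT, hTe⟩ := truncated_mean r a b
  refine ⟨(F * (B + G) + A * G) + 3 * (|mu a b r| + A * B) + 4 * T, by positivity, ?_⟩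
  filter_upwards [hAe, hBe, hTe, eventually_ge_atTop 2] with K hAK hBK hTK hK m _ hm hm3 hlog
  have hm0 : (0 : ℝ) < m := by exact_mod_cast hm.pos
  have hm1 : (1 : ℝ) ≤ m := by exact_mod_cast hm.one_le
  have hm3' : (3 : ℝ) ≤ m := by exact_mod_cast hm3
  have hK1 : (1 : ℝ) ≤ K := by exact_mod_cast (by omega : 1 ≤ K)
  -- `c = 9` since `8/9 = 1 - 1/9`; the power `a + b + 1` covers the loss `m^a` or `m^b` and still
  -- leaves `1/m`.
  have h89 : (8 / 9 : ℝ) ^ K ≤ ((m : ℝ) ^ (a + b + 1))⁻¹ :=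
    geometric_le_inv (c := 9) (by norm_num) (by norm_num) (by norm_num) hm0 _ hlog
  have h45 : (4 / 5 : ℝ) ^ K ≤ 1 / m := by
    calc (4 / 5 : ℝ) ^ K ≤ (8 / 9) ^ K :=
          pow_le_pow_left₀ (by norm_num) (by norm_num) K
      _ ≤ _ := h89
      _ ≤ _ := by
        rw [one_div]
        gcongr
        exact le_self_pow₀ hm1 (by omega)
  have hsmall (c : ℕ) (hc : c ≤ a + b) : (m : ℝ) ^ c * (8 / 9) ^ K ≤ 1 / m := by
    calc (m : ℝ) ^ c * (8 / 9) ^ K ≤ (m : ℝ) ^ (a + b) * ((m : ℝ) ^ (a + b + 1))⁻¹ := by gcongr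
      _ = 1 / m := by rw [pow_succ]; field_simp
  have hmle : 1 / (m : ℝ) ≤ 1 := by rw [div_le_one hm0]; exact hm1
  set P : ℝ := (K : ℝ) ^ ((r + 1) * (a + b) + 1) with hP
  have hP1 : 1 ≤ P := one_le_pow₀ hK1
  have hPa : (K : ℝ) ^ ((r + 1) * a) ≤ P :=
    pow_le_pow_right₀ hK1 (by rw [mul_add]; omega)
  have hPb : (K : ℝ) ^ ((r + 1) * b) ≤ P :=
    pow_le_pow_right₀ hK1 (by rw [mul_add]; omega)
  have hPab : (K : ℝ) ^ ((r + 1) * a) * (K : ℝ) ^ ((r + 1) * b) ≤ P := by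
    rw [← pow_add]
    exact pow_le_pow_right₀ hK1 (by rw [mul_add]; omega)
  set ε : ℂ := (-1) ^ ((r + 1) * (a + b)) with hε
  have hεn : ‖ε‖ = 1 := by simp [hε]
  set S : ℕ → DirichletCharacter ℂ m → ℂ := fun k χ => ∑' n : ℕ, χ n * (truncTerm r k K n : ℂ)
    with hS
  have hSa (χ : DirichletCharacter ℂ m) : ‖S a χ‖ ≤ A * (K : ℝ) ^ ((r + 1) * a) :=
    (norm_tsum_char_mul_le χ (summable_truncTerm r a hK) (truncTerm_nonneg r a K)).trans hAK
  have hSb (χ : DirichletCharacter ℂ m) : ‖S b χ‖ ≤ B * (K : ℝ) ^ ((r + 1) * b) :=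
    (norm_tsum_char_mul_le χ (summable_truncTerm r b hK) (truncTerm_nonneg r b K)).trans hBK
  have hχ (χ : DirichletCharacter ℂ m) (h : χ ≠ 1) :
      ‖momentPoly a b (logDerivLAtOne r χ) - ε * (S a χ * starRingEnd ℂ (S b χ))‖ ≤
        (F * (B + G) + A * G) * (P / m) := by
    have e1 : ‖logDerivLAtOne r χ ^ a - (-1) ^ ((r + 1) * a) * S a χ‖ ≤ F * (1 / m) :=
      (hFe m χ h K).trans (by rw [mul_assoc]; gcongr; exact hsmall a (by omega))
    have e2 : ‖logDerivLAtOne r χ ^ b - (-1) ^ ((r + 1) * b) * S b χ‖ ≤ G * (1 / m) :=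
      (hGe m χ h K).trans (by rw [mul_assoc]; gcongr; exact hsmall b (by omega))
    have na : ‖(-1) ^ ((r + 1) * a) * S a χ‖ ≤ A * P := by
      rw [norm_mul, norm_pow, norm_neg, norm_one, one_pow, one_mul]
      exact (hSa χ).trans (by gcongr)
    have nb : ‖(-1) ^ ((r + 1) * b) * S b χ‖ ≤ B * P := by
      rw [norm_mul, norm_pow, norm_neg, norm_one, one_pow, one_mul]
      exact (hSb χ).trans (by gcongr)
    have e3 := norm_mul_star_sub_le _ _ _ _ e1 e2 na nb
    have e4 : momentPoly a b (logDerivLAtOne r χ) - ε * (S a χ * starRingEnd ℂ (S b χ)) =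
        logDerivLAtOne r χ ^ a * starRingEnd ℂ (logDerivLAtOne r χ ^ b) -
        (-1) ^ ((r + 1) * a) * S a χ * starRingEnd ℂ ((-1) ^ ((r + 1) * b) * S b χ) := by
      rw [momentPoly, hε, mul_add, pow_add]
      simp only [map_pow, map_mul, map_neg, map_one]
      ring
    rw [e4]
    refine e3.trans ?_
    calc _ ≤ F * (1 / m) * (B * P + G * P) + A * P * (G * (1 / m)) := by
          gcongr
          exact hmle.trans hP1
      _ = _ := by ring
  have hcard := card_nonprincipalChars hm
  have htot : (m.totient : ℝ) = m - 1 := by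
    rw [Nat.totient_prime hm, Nat.cast_sub hm.one_le, Nat.cast_one]
  have htotC : (m.totient : ℂ) = ((m - 1 : ℝ) : ℂ) := by rw [← htot]; simp
  have hcardC : ((nonprincipalChars m).card : ℂ) = ((m - 2 : ℝ) : ℂ) := by rw [← hcard]; simp
  have hn0 : (0 : ℝ) < m - 2 := by linarith
  have hinv : 1 / (m - 2 : ℝ) ≤ 3 * (1 / m) := by
    rw [mul_one_div, div_le_div_iff₀ hn0 hm0]; linarith
  have hsplit : ∑ χ ∈ nonprincipalChars m, S a χ * starRingEnd ℂ (S b χ) =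
      ∑ χ, S a χ * starRingEnd ℂ (S b χ) - S a 1 * starRingEnd ℂ (S b 1) := by
    rw [nonprincipalChars, Finset.filter_ne', eq_sub_iff_add_eq,
      Finset.sum_erase_add _ _ (Finset.mem_univ _)]
  have hTm := hTK m hm
  change ‖∑ χ, S a χ * starRingEnd ℂ (S b χ) - _‖ ≤ _ at hTm
  set R := ∑ χ, S a χ * starRingEnd ℂ (S b χ) - m.totient * (mu a b r : ℂ) with hR
  have hne : ((m - 2 : ℝ) : ℂ) ≠ 0 := by exact_mod_cast hn0.ne'
  -- Orthogonality needs all characters, so the principal one is subtracted. There are `m - 2`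
  -- characters left against `φ(m) = m - 1`, which produces the extra `mu`.
  have hdecomp : moment m r a b - ε * (mu a b r : ℂ) =
      (1 / ((m - 2 : ℝ) : ℂ)) * (∑ χ ∈ nonprincipalChars m,
        (momentPoly a b (logDerivLAtOne r χ) - ε * (S a χ * starRingEnd ℂ (S b χ)))) +
      (1 / ((m - 2 : ℝ) : ℂ)) * (ε * (R + (mu a b r : ℂ) - S a 1 * starRingEnd ℂ (S b 1))) := by
    rw [Finset.sum_sub_distrib, ← Finset.mul_sum, hsplit, hR, htotC, moment, hcardC]
    field_simp
    push_cast
    ring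
  have hinvn : ‖(1 / ((m - 2 : ℝ) : ℂ))‖ = 1 / (m - 2 : ℝ) := by
    rw [norm_div, norm_one, Complex.norm_real, Real.norm_of_nonneg hn0.le]
  rw [hdecomp]
  refine (norm_add_le _ _).trans ?_
  have hfirst : ‖(1 / ((m - 2 : ℝ) : ℂ)) * (∑ χ ∈ nonprincipalChars m,
      (momentPoly a b (logDerivLAtOne r χ) - ε * (S a χ * starRingEnd ℂ (S b χ))))‖ ≤
      (F * (B + G) + A * G) * (P / m) := by
    rw [norm_mul, hinvn, one_div, inv_mul_le_iff₀ hn0, ← hcard, ← nsmul_eq_mul,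
      ← Finset.sum_const]
    exact norm_sum_le_of_le _ fun χ h => hχ χ (Finset.mem_filter.1 h).2
  have hsecond : ‖(1 / ((m - 2 : ℝ) : ℂ)) *
      (ε * (R + (mu a b r : ℂ) - S a 1 * starRingEnd ℂ (S b 1)))‖ ≤
      (3 * (|mu a b r| + A * B) + 4 * T) * (P / m) := by
    have hR' : ‖R‖ ≤ (m - 1) * (T * (2 * (P / m))) := by
      refine hTm.trans ?_
      rw [htot]
      gcongr
      have : 1 / (m : ℝ) ≤ P / m := by gcongr
      linarith
    have hprin : ‖S a 1 * starRingEnd ℂ (S b 1)‖ ≤ A * B * P := by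
      rw [norm_mul, RCLike.norm_conj]
      calc _ ≤ (A * (K : ℝ) ^ ((r + 1) * a)) * (B * (K : ℝ) ^ ((r + 1) * b)) := by
            gcongr
            · exact hSa 1
            · exact hSb 1
        _ = A * B * ((K : ℝ) ^ ((r + 1) * a) * (K : ℝ) ^ ((r + 1) * b)) := by ring
        _ ≤ _ := by gcongr
    rw [norm_mul, norm_mul, hεn, one_mul, hinvn]
    have hmu : ‖(mu a b r : ℂ)‖ ≤ |mu a b r| * P := by
      rw [Complex.norm_real, Real.norm_eq_abs]
      exact le_mul_of_one_le_right (abs_nonneg _) hP1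
    have hsum : ‖R + (mu a b r : ℂ) - S a 1 * starRingEnd ℂ (S b 1)‖ ≤
        (m - 1) * (T * (2 * (P / m))) + (|mu a b r| + A * B) * P := by
      refine (norm_sub_le _ _).trans ?_
      have := norm_add_le R (mu a b r : ℂ)
      linarith
    have h2 : 1 / (m - 2 : ℝ) * (m - 1) ≤ 2 := by
      rw [one_div_mul_eq_div, div_le_iff₀ hn0]; linarith
    calc _ ≤ 1 / (m - 2 : ℝ) * ((m - 1) * (T * (2 * (P / m))) + (|mu a b r| + A * B) * P) := by
          gcongr
      _ = 1 / (m - 2 : ℝ) * (m - 1) * (T * (2 * (P / m))) +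
          1 / (m - 2 : ℝ) * ((|mu a b r| + A * B) * P) := by ring
      _ ≤ 2 * (T * (2 * (P / m))) + 3 * (1 / m) * ((|mu a b r| + A * B) * P) := by gcongr
      _ = _ := by ring
  linarith

theorem moment_sub_eventually_le (hGRH : GeneralizedRiemannHypothesis) (r a b : ℕ) :
    ∃ m₀ : ℕ, ∀ (m : ℕ) [NeZero m], m.Prime → m₀ ≤ m →
      ‖moment m r a b - (-1 : ℂ) ^ ((r + 1) * (a + b)) * (mu a b r : ℂ)‖ ≤
        Real.log (m : ℝ) ^ ((r + 1) * (a + b) + 2) / (m : ℝ) := by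
  obtain ⟨C, hC, hCe⟩ := moment_sub_le hGRH r a b
  obtain ⟨K₀, hK₀⟩ := eventually_atTop.1 hCe
  set c : ℝ := 9 * ((a + b + 1 : ℕ) : ℝ) with hc
  have hc9 : 9 ≤ c := by
    have : (1 : ℝ) ≤ ((a + b + 1 : ℕ) : ℝ) := by exact_mod_cast Nat.le_add_left 1 (a + b)
    linarith
  have hlogt : Tendsto (fun m : ℕ => Real.log m) atTop atTop :=
    Real.tendsto_log_atTop.comp tendsto_natCast_atTop_atTop
  -- Besides making `K` large enough, `m₀` forces `log m` to exceed the whole constant in front;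
  -- this uses the spare logarithm.
  obtain ⟨m₀, hm₀⟩ := eventually_atTop.1 ((hlogt.eventually_ge_atTop
    (max 1 (max K₀ (C * (c + 1) ^ ((r + 1) * (a + b) + 1))))).and (eventually_ge_atTop 3))
  refine ⟨m₀, fun m _ hm hmm => ?_⟩
  obtain ⟨hl, hm3⟩ := hm₀ m hmm
  simp only [max_le_iff] at hl
  obtain ⟨hl1, hlK, hlC⟩ := hl
  have hm0 : (0 : ℝ) < m := by exact_mod_cast hm.pos
  set K := ⌈c * Real.log m⌉₊ with hK
  have hKge : c * Real.log m ≤ K := Nat.le_ceil _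
  have hKle : (K : ℝ) ≤ (c + 1) * Real.log m := by
    have := Nat.ceil_lt_add_one (show 0 ≤ c * Real.log m by positivity)
    linarith
  have hKK : K₀ ≤ K := by
    have : (K₀ : ℝ) ≤ K := by nlinarith
    exact_mod_cast this
  refine (hK₀ K hKK m hm hm3 hKge).trans ?_
  rw [← mul_div_assoc]
  gcongr
  calc C * (K : ℝ) ^ ((r + 1) * (a + b) + 1)
      ≤ C * ((c + 1) * Real.log m) ^ ((r + 1) * (a + b) + 1) := by gcongr
    _ = C * (c + 1) ^ ((r + 1) * (a + b) + 1) * Real.log m ^ ((r + 1) * (a + b) + 1) := by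
        rw [mul_pow]; ring
    _ ≤ Real.log m * Real.log m ^ ((r + 1) * (a + b) + 1) := by gcongr
    _ = _ := by rw [pow_succ' _ ((r + 1) * (a + b) + 1)]

theorem theorem1p2 (hGRH : GeneralizedRiemannHypothesis) (a b : ℕ) :
    (∀ r : ℕ, Summable (fun j : ℕ+ => muTerm a b r j)) ∧
    (∃ C : ℝ, ∀ r : ℕ, ∃ m₀ : ℕ, ∀ (m : ℕ) [Fact m.Prime], m₀ ≤ m →
      ‖moment m r a b - (-1 : ℂ) ^ ((r + 1) * (a + b)) * (mu a b r : ℂ)‖ ≤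
        C * (Real.log (m : ℝ) ^ ((r + 1) * (a + b) + 2) / (m : ℝ))) ∧
    (∀ r : ℕ, Tendsto (fun m : Nat.Primes => moment (m : ℕ) r a b)
      (comap (fun m : Nat.Primes => (m : ℕ)) atTop)
      (𝓝 ((-1 : ℂ) ^ ((r + 1) * (a + b)) * (mu a b r : ℂ)))) := by
  -- The constant 1 serves every `r`, since all dependence on `r` has moved into `m₀`.
  refine ⟨fun r => (summable_muTerm a b r).comp_injective PNat.coe_injective, ⟨1, fun r => ?_⟩,
    fun r => ?_⟩
  · obtain ⟨m₀, h⟩ := moment_sub_eventually_le hGRH r a b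
    exact ⟨m₀, fun m hm hmm => (h m hm.out hmm).trans_eq (one_mul _).symm⟩
  · obtain ⟨m₀, h⟩ := moment_sub_eventually_le hGRH r a b
    have hlim : Tendsto (fun m : ℕ => Real.log (m : ℝ) ^ ((r + 1) * (a + b) + 2) / (m : ℝ))
        atTop (𝓝 0) :=
      Real.isLittleO_pow_log_id_atTop.tendsto_div_nhds_zero.comp tendsto_natCast_atTop_atTop
    refine tendsto_iff_norm_sub_tendsto_zero.2 (squeeze_zero' (.of_forall fun _ => norm_nonneg _)
      ?_ (hlim.comp tendsto_comap))
    filter_upwards [tendsto_comap.eventually (eventually_ge_atTop m₀)] with m hm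
    exact h m m.2 hm
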